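/- **Lemma 2.1 (spinor bundle of a product).** Let $(M_1^{k_1},g_1)$ and $(M_2^{k_2},g_2)$ be oriented Riemannian manifolds with $\mathrm{spin}^{\mathbb C}$ structures with associated complex line bundles $L_1$, $L_2$. Let $\pi_i:M_1\times M_2\to M_i$ be the projections, and equip $(M_1\times M_2,\ g_1+g_2)$ with the product $\mathrm{spin}^{\mathbb C}$ structure, obtained by extending the structure group along $\mathrm{Spin}^{\mathbb C}(k_1)\times_{S^1}\mathrm{Spin}^{\mathbb C}(k_2)\to \mathrm{Spin}^{\mathbb C}(k_1+k_2)$; its line bundle is $L=\pi_1^*L_1\otimes\pi_2^*L_2$. Here $\Sigma(M^n,L)$ is the vector bundle associated to the $\mathrm{Spin}^{\mathbb C}(n)$-principal bundle by an irreducible complex module $\triangle_n$ of the Clifford algebra $\mathrm{Cl}(\mathbb R^n)$ ($e_i^2=-1$), with its Clifford multiplication by tangent vectors. For odd $n=2q+1$ there are two such modules; $\Sigma'(M,L)$ and $\Sigma''(M,L)$ are the spinor bundles on which the volume form $\mu=E_1\cdots E_n$ acts as $+(\sqrt{-1})^{q+1}$ and $-(\sqrt{-1})^{q+1}$, and we say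 that they have sign $+1$ and $-1$. 1. If at least one of $k_1,k_2$ is even, then (for every choice of the spinor bundles of odd-dimensional manifolds involved) there is a smooth isomorphism of complex vector bundles $$\Sigma(M_1\times M_2,L)\;\cong\;\pi_1^*\Sigma(M_1,L_1)\otimes\pi_2^*\Sigma(M_2,L_2).$$ If $k_1=2p$, it can be chosen to carry the Clifford multiplication by $(v_1,v_2)$ to $$\varphi_1\otimes\varphi_2\ \mapsto\ (v_1\cdot\varphi_1)\otimes\varphi_2+(\sqrt{-1})^p(\mu_1\cdot\varphi_1)\otimes(v_2\cdot\varphi_2),$$ provided, in case $k_2$ is odd, that the sign of $\Sigma(M_1\times M_2,L)$ is $(-1)^p$ times the sign of $\Sigma(M_2,L_2)$. If $k_2=2p$, it can be chosen to carry the Clifford multiplication by $(v_1,v_2)$ to $$\varphi_1\otimes\varphi_2\ \mapsto\ (\sqrt{-1})^p(v_1\cdot\varphi_1)\otimes(\mu_2\cdot\varphi_2)+\varphi_1\otimes(v_2\cdot\varphi_2),$$ provided, in case $k_1$ is odd, that the sign of $\Sigma(M_1\times M_2,L)$ is $(-1)^p$ times the sign of $\Sigma(M_1,L_1)$. 2.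 If $k_1$ and $k_2$ are both odd, then for either choice of $\Sigma(M_2,L_2)$ there is a smooth isomorphism of complex vector bundles $$\Sigma(M_1\times M_2,L)\;\cong\;\bigl(\pi_1^*\Sigma'(M_1,L_1)\oplus\pi_1^*\Sigma''(M_1,L_1)\bigr)\otimes\pi_2^*\Sigma(M_2,L_2)$$ and a smooth isomorphism of complex vector bundles $J:\Sigma''(M_1,L_1)\to\Sigma'(M_1,L_1)$ with $J(v\cdot\varphi)=-v\cdot J\varphi$, such that the former carries the Clifford multiplication by $(v_1,v_2)$ to $$(\varphi',\varphi'')\otimes\varphi_2\ \mapsto\ (v_1\cdot\varphi',\,v_1\cdot\varphi'')\otimes\varphi_2+(J\varphi'',\,J^{-1}\varphi')\otimes(v_2\cdot\varphi_2).$$ -/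

import Mathlib

open scoped Manifold ContDiff TensorProduct
open Bundle Set
set_option linter.unusedSectionVars false

noncomputable section
namespace SpinC

section Bundles
variable {E H M : Type*} [NormedAddCommGroup E] [NormedSpace ℝ E] [TopologicalSpace H]
  [TopologicalSpace M] [ChartedSpace H M]
  {E' H' M' : Type*} [NormedAddCommGroup E'] [NormedSpace ℝ E'] [TopologicalSpace H']
  [TopologicalSpace M'] [ChartedSpace H' M']
  {F F' : Type*} [NormedAddCommGroup F] [InnerProductSpace ℂ F] [FiniteDimensional ℂ F]
  [NormedAddCommGroup F'] [InnerProductSpace ℂ F'] [FiniteDimensional ℂ F']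

/-- A smooth complex vector bundle with model fibre `F`, given by a smooth cocycle of transition
maps over an open cover indexed by `ι`. -/
structure SmoothBundle (I : ModelWithCorners ℝ E H) (M : Type*) [TopologicalSpace M]
    [ChartedSpace H M] (F : Type*) [NormedAddCommGroup F] [InnerProductSpace ℂ F] (ι : Type*)
    extends VectorBundleCore ℂ M F ι where
  smooth_coordChange : ∀ i j,
    ContMDiffOn I 𝓘(ℝ, F →L[ℂ] F) ∞ (coordChange i j) (baseSet i ∩ baseSet j)

variable {I : ModelWithCorners ℝ E H} {I' : ModelWithCorners ℝ E' H'} {ι ι' : Type*}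

namespace SmoothBundle

/-- The pull-back `f^*B`. -/
def pullback (B : SmoothBundle I' M' F ι) (f : M → M') (hf : ContMDiff I I' ∞ f) :
    SmoothBundle I M F ι where
  baseSet i := f ⁻¹' B.baseSet i
  isOpen_baseSet i := (B.isOpen_baseSet i).preimage hf.continuous
  indexAt x := B.indexAt (f x)
  mem_baseSet_at x := B.mem_baseSet_at (f x)
  coordChange i j x := B.coordChange i j (f x)
  coordChange_self i x hx := B.coordChange_self i (f x) hx
  continuousOn_coordChange i j :=
    (B.continuousOn_coordChange i j).comp hf.continuous.continuousOn fun _ hx => hx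
  coordChange_comp i j k x hx := B.coordChange_comp i j k (f x) hx
  smooth_coordChange i j := (B.smooth_coordChange i j).comp hf.contMDiffOn fun _ hx => hx

theorem contMDiffOn_linear {V W : Type*} [NormedAddCommGroup V] [NormedSpace ℝ V]
    [FiniteDimensional ℝ V] [NormedAddCommGroup W] [NormedSpace ℝ W] (L : V →ₗ[ℝ] W)
    {f : M → V} {s : Set M} (hf : ContMDiffOn I 𝓘(ℝ, V) ∞ f s) :
    ContMDiffOn I 𝓘(ℝ, W) ∞ (fun x => L (f x)) s :=
  (LinearMap.toContinuousLinearMap L).contMDiff.comp_contMDiffOn hf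

theorem contMDiffOn_bilinear {V₁ V₂ W : Type*} [NormedAddCommGroup V₁] [NormedSpace ℝ V₁]
    [FiniteDimensional ℝ V₁] [NormedAddCommGroup V₂] [NormedSpace ℝ V₂]
    [FiniteDimensional ℝ V₂] [NormedAddCommGroup W] [NormedSpace ℝ W]
    (L : V₁ →ₗ[ℝ] V₂ →ₗ[ℝ] W) {f₁ : M → V₁} {f₂ : M → V₂} {s : Set M}
    (h₁ : ContMDiffOn I 𝓘(ℝ, V₁) ∞ f₁ s) (h₂ : ContMDiffOn I 𝓘(ℝ, V₂) ∞ f₂ s) :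
    ContMDiffOn I 𝓘(ℝ, W) ∞ (fun x => L (f₁ x) (f₂ x)) s :=
  (contMDiffOn_linear (LinearMap.toContinuousLinearMap.toLinearMap ∘ₗ L :
    V₁ →ₗ[ℝ] (V₂ →L[ℝ] W)) h₁).clm_apply h₂

/-- The tensor product `B ⊗ B'` over `ℂ`. -/
def tensor (B : SmoothBundle I M F ι) (B' : SmoothBundle I M F' ι') :
    SmoothBundle I M (F ⊗[ℂ] F') (ι × ι') :=
  have sm : ∀ i j : ι × ι', ContMDiffOn I 𝓘(ℝ, (F ⊗[ℂ] F') →L[ℂ] (F ⊗[ℂ] F')) ∞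
      (fun x => TensorProduct.mapL (B.coordChange i.1 j.1 x) (B'.coordChange i.2 j.2 x))
      ((B.baseSet i.1 ∩ B'.baseSet i.2) ∩ (B.baseSet j.1 ∩ B'.baseSet j.2)) := fun i j => by
    let _ : FiniteDimensional ℝ (F →L[ℂ] F) := FiniteDimensional.complexToReal _
    let _ : FiniteDimensional ℝ (F' →L[ℂ] F') := FiniteDimensional.complexToReal _
    exact contMDiffOn_bilinear (LinearMap.mk₂ ℝ
      (fun (a : F →L[ℂ] F) (b : F' →L[ℂ] F') => TensorProduct.mapL a b)
      TensorProduct.mapL_add_left (fun c a b => TensorProduct.mapL_smul_left (c : ℂ) a b)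
      TensorProduct.mapL_add_right (fun c a b => TensorProduct.mapL_smul_right (c : ℂ) a b))
      ((B.smooth_coordChange i.1 j.1).mono fun x hx => ⟨hx.1.1, hx.2.1⟩)
      ((B'.smooth_coordChange i.2 j.2).mono fun x hx => ⟨hx.1.2, hx.2.2⟩)
  { baseSet := fun i => B.baseSet i.1 ∩ B'.baseSet i.2
    isOpen_baseSet := fun i => (B.isOpen_baseSet i.1).inter (B'.isOpen_baseSet i.2)
    indexAt := fun x => (B.indexAt x, B'.indexAt x)
    mem_baseSet_at := fun x => ⟨B.mem_baseSet_at x, B'.mem_baseSet_at x⟩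
    coordChange := fun i j x =>
      TensorProduct.mapL (B.coordChange i.1 j.1 x) (B'.coordChange i.2 j.2 x)
    coordChange_self := fun i x hx v => by
      have h₁ : B.coordChange i.1 i.1 x = .id ℂ F := by
        ext v; exact B.coordChange_self _ _ hx.1 v
      have h₂ : B'.coordChange i.2 i.2 x = .id ℂ F' := by
        ext v; exact B'.coordChange_self _ _ hx.2 v
      rw [h₁, h₂]; simp
    continuousOn_coordChange := fun i j => (sm i j).continuousOn
    coordChange_comp := fun i j k x hx v => by
      have h₁ : B.coordChange i.1 k.1 x =
          (B.coordChange j.1 k.1 x).comp (B.coordChange i.1 j.1 x) := by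
        ext v
        exact (B.coordChange_comp _ _ _ _ ⟨⟨hx.1.1.1, hx.1.2.1⟩, hx.2.1⟩ v).symm
      have h₂ : B'.coordChange i.2 k.2 x =
          (B'.coordChange j.2 k.2 x).comp (B'.coordChange i.2 j.2 x) := by
        ext v
        exact (B'.coordChange_comp _ _ _ _ ⟨⟨hx.1.1.2, hx.1.2.2⟩, hx.2.2⟩ v).symm
      rw [h₁, h₂, TensorProduct.mapL_comp]; rfl
    smooth_coordChange := sm }

/-- The endomorphism `a ⊕ b` of `F ⊕ F'`. -/
def sumMap (a : F →ₗ[ℂ] F) (b : F' →ₗ[ℂ] F') : WithLp 2 (F × F') →ₗ[ℂ] WithLp 2 (F × F') :=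
  (WithLp.linearEquiv 2 ℂ (F × F')).symm.toLinearMap ∘ₗ a.prodMap b ∘ₗ
    (WithLp.linearEquiv 2 ℂ (F × F')).toLinearMap

/-- The direct sum `B ⊕ B'`. -/
def directSum (B : SmoothBundle I M F ι) (B' : SmoothBundle I M F' ι') :
    SmoothBundle I M (WithLp 2 (F × F')) (ι × ι') :=
  have sm : ∀ i j : ι × ι',
      ContMDiffOn I 𝓘(ℝ, WithLp 2 (F × F') →L[ℂ] WithLp 2 (F × F')) ∞
      (fun x => LinearMap.toContinuousLinearMap
        (sumMap (B.coordChange i.1 j.1 x : F →ₗ[ℂ] F) (B'.coordChange i.2 j.2 x : F' →ₗ[ℂ] F')))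
      ((B.baseSet i.1 ∩ B'.baseSet i.2) ∩ (B.baseSet j.1 ∩ B'.baseSet j.2)) := fun i j => by
    let _ : FiniteDimensional ℝ (F →L[ℂ] F) := FiniteDimensional.complexToReal _
    let _ : FiniteDimensional ℝ (F' →L[ℂ] F') := FiniteDimensional.complexToReal _
    let L : ((F →L[ℂ] F) × (F' →L[ℂ] F')) →ₗ[ℝ]
        (WithLp 2 (F × F') →L[ℂ] WithLp 2 (F × F')) :=
      { toFun := fun p => LinearMap.toContinuousLinearMap
          (sumMap (p.1 : F →ₗ[ℂ] F) (p.2 : F' →ₗ[ℂ] F'))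
        map_add' := fun p q => by ext v; rfl
        map_smul' := fun c p => by ext v; rfl }
    exact contMDiffOn_linear L (f := fun x => (B.coordChange i.1 j.1 x, B'.coordChange i.2 j.2 x))
      (((B.smooth_coordChange i.1 j.1).mono fun x hx => ⟨hx.1.1, hx.2.1⟩).prodMk_space
      ((B'.smooth_coordChange i.2 j.2).mono fun x hx => ⟨hx.1.2, hx.2.2⟩))
  { baseSet := fun i => B.baseSet i.1 ∩ B'.baseSet i.2
    isOpen_baseSet := fun i => (B.isOpen_baseSet i.1).inter (B'.isOpen_baseSet i.2)
    indexAt := fun x => (B.indexAt x, B'.indexAt x)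
    mem_baseSet_at := fun x => ⟨B.mem_baseSet_at x, B'.mem_baseSet_at x⟩
    coordChange := fun i j x => LinearMap.toContinuousLinearMap
      (sumMap (B.coordChange i.1 j.1 x : F →ₗ[ℂ] F) (B'.coordChange i.2 j.2 x : F' →ₗ[ℂ] F'))
    coordChange_self := fun i x hx v => by
      apply (WithLp.linearEquiv 2 ℂ (F × F')).injective
      exact Prod.ext (B.coordChange_self _ _ hx.1 _) (B'.coordChange_self _ _ hx.2 _)
    continuousOn_coordChange := fun i j => (sm i j).continuousOn
    coordChange_comp := fun i j k x hx v => by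
      apply (WithLp.linearEquiv 2 ℂ (F × F')).injective
      exact Prod.ext (B.coordChange_comp _ _ _ _ ⟨⟨hx.1.1.1, hx.1.2.1⟩, hx.2.1⟩ _)
        (B'.coordChange_comp _ _ _ _ ⟨⟨hx.1.1.2, hx.1.2.2⟩, hx.2.2⟩ _)
    smooth_coordChange := sm }

/-- The external tensor product `π₁^*B ⊗ π₂^*B'` over `M × M'`. -/
abbrev boxTensor (B : SmoothBundle I M F ι) (B' : SmoothBundle I' M' F' ι') :
    SmoothBundle (I.prod I') (M × M') (F ⊗[ℂ] F') (ι × ι') :=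
  (B.pullback Prod.fst contMDiff_fst).tensor (B'.pullback Prod.snd contMDiff_snd)

end SmoothBundle

/-- A smooth isomorphism of complex vector bundles over the identity: a family of complex linear
isomorphisms of the fibres which is smooth in every pair of local trivialisations. -/
structure BundleIso (B : SmoothBundle I M F ι) (B' : SmoothBundle I M F' ι') where
  /-- the isomorphism of the fibres over `x` -/
  toFun : ∀ x, B.Fiber x ≃L[ℂ] B'.Fiber x
  smooth : ∀ i j, ContMDiffOn I 𝓘(ℝ, F →L[ℂ] F') ∞
    (fun x => (B'.coordChange (B'.indexAt x) j x).comp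
      (((toFun x : B.Fiber x →L[ℂ] B'.Fiber x) : F →L[ℂ] F').comp
        (B.coordChange i (B.indexAt x) x)))
    (B.baseSet i ∩ B'.baseSet j)

end Bundles
section Metric
variable {E H M : Type*} [NormedAddCommGroup E] [NormedSpace ℝ E] [FiniteDimensional ℝ E]
  [TopologicalSpace H] [TopologicalSpace M] [ChartedSpace H M]
  {E' H' M' : Type*} [NormedAddCommGroup E'] [NormedSpace ℝ E'] [FiniteDimensional ℝ E']
  [TopologicalSpace H'] [TopologicalSpace M'] [ChartedSpace H' M']
  {I : ModelWithCorners ℝ E H} {I' : ModelWithCorners ℝ E' H'}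
  [IsManifold I ∞ M] [IsManifold I' ∞ M']

/-- Smooth Riemannian metrics on `M`. -/
abbrev Metric (I : ModelWithCorners ℝ E H) (M : Type*) [TopologicalSpace M] [ChartedSpace H M]
    [IsManifold I ∞ M] :=
  ContMDiffRiemannianMetric I ∞ E (fun x : M => TangentSpace I x)

theorem contMDiffAt_of_apply {V W : Type*} [NormedAddCommGroup V] [NormedSpace ℝ V]
    [FiniteDimensional ℝ V] [NormedAddCommGroup W] [NormedSpace ℝ W] {f : M → V →L[ℝ] W} {x : M}
    (h : ∀ v, ContMDiffAt I 𝓘(ℝ, W) ∞ (fun y => f y v) x) :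
    ContMDiffAt I 𝓘(ℝ, V →L[ℝ] W) ∞ f x := by
  let e : V ≃L[ℝ] (Fin (Module.finrank ℝ V) → ℝ) :=
    ContinuousLinearEquiv.ofFinrankEq (by simp)
  let e₁ := e.arrowCongr (ContinuousLinearEquiv.refl ℝ W)
  let e₂ := ContinuousLinearEquiv.piRing (𝕜 := ℝ) (E := W) (Fin (Module.finrank ℝ V))
  have h' : ContMDiffAt I 𝓘(ℝ, Fin (Module.finrank ℝ V) → W) ∞ (fun y => e₂ (e₁ (f y))) x := by
    rw [contMDiffAt_pi_space]
    intro k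
    exact h (e.symm (Pi.single k 1))
  have := ((e₁.trans e₂).symm.contDiff (n := ∞)).contMDiff.contMDiffAt.comp x h'
  refine this.congr_of_eventuallyEq (Filter.Eventually.of_forall fun y => ?_)
  simp

/-- The inner product `g(v₁, w₁) + g'(v₂, w₂)` on `T_(x,y)(M × M') = T_x M × T_y M'`. -/
def prodInner (g : Metric I M) (g' : Metric I' M') (p : M × M') :
    TangentSpace (I.prod I') p →L[ℝ] TangentSpace (I.prod I') p →L[ℝ] ℝ :=
  show (E × E') →L[ℝ] (E × E') →L[ℝ] ℝ from ((show E →L[ℝ] E →L[ℝ] ℝ from g.inner p.1).bilinearComp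
    (ContinuousLinearMap.fst ℝ E E') (ContinuousLinearMap.fst ℝ E E')) +
  ((show E' →L[ℝ] E' →L[ℝ] ℝ from g'.inner p.2).bilinearComp
    (ContinuousLinearMap.snd ℝ E E') (ContinuousLinearMap.snd ℝ E E'))

theorem prodInner_contMDiff (g : Metric I M) (g' : Metric I' M') :
   ContMDiff (I.prod I') ((I.prod I').prod 𝓘(ℝ, (E × E') →L[ℝ] (E × E') →L[ℝ] ℝ)) ∞
    (fun p : M × M' ↦ TotalSpace.mk' ((E × E') →L[ℝ] (E × E') →L[ℝ] ℝ) 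
      (E := fun p : M × M' => TangentSpace (I.prod I') p →L[ℝ] TangentSpace (I.prod I') p →L[ℝ] ℝ) p (prodInner g g' p)) := by
  intro p₀
  rw [contMDiffAt_hom_bundle]
  refine ⟨contMDiffAt_id, ?_⟩
  apply contMDiffAt_of_apply
  intro v
  apply contMDiffAt_of_apply
  intro w
  set t := trivializationAt (E × E') (TangentSpace (I.prod I') : M × M' → Type _) p₀
  have hs : ∀ u : E × E', ContMDiffAt (I.prod I') (I.prod I').tangent ∞
      (fun p : M × M' => (⟨p, t.symmL ℝ p u⟩ : TangentBundle (I.prod I') (M × M'))) p₀ := by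
    intro u
    have hb : p₀ ∈ t.baseSet := mem_baseSet_trivializationAt _ _ _
    rw [contMDiffAt_totalSpace]
    refine ⟨contMDiffAt_id, (contMDiffAt_const (c := u)).congr_of_eventuallyEq ?_⟩
    filter_upwards [t.open_baseSet.mem_nhds hb] with p hp
    simp only [Trivialization.symmL_apply _ hp]
    exact congrArg Prod.snd (t.apply_mk_symm hp u)
  have h1 : ∀ u : E × E', ContMDiffAt (I.prod I') I.tangent ∞
      (fun p : M × M' => (⟨p.1, (show E × E' from t.symmL ℝ p u).1⟩ : TangentBundle I M)) p₀ := by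
    intro u
    exact (contMDiff_equivTangentBundleProd (I := I) (I' := I') (M := M) (M' := M') (n := ∞)).contMDiffAt.comp p₀ (hs u) |>.fst
  have h2 : ∀ u : E × E', ContMDiffAt (I.prod I') I'.tangent ∞
      (fun p : M × M' => (⟨p.2, (show E × E' from t.symmL ℝ p u).2⟩ : TangentBundle I' M')) p₀ := by
    intro u
    exact (contMDiff_equivTangentBundleProd (I := I) (I' := I') (M := M) (M' := M') (n := ∞)).contMDiffAt.comp p₀ (hs u) |>.snd
  have key : ContMDiffAt (I.prod I') 𝓘(ℝ, ℝ) ∞ (fun p : M × M' =>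
      prodInner g g' p (t.symmL ℝ p v) (t.symmL ℝ p w)) p₀ := by
    have a1 : ContMDiffAt (I.prod I') (I.prod 𝓘(ℝ, ℝ)) ∞ (fun p : M × M' =>
       TotalSpace.mk' ℝ (E := Bundle.Trivial M ℝ) p.1 (g.inner p.1 (show E × E' from t.symmL ℝ p v).1 
        (show E × E' from t.symmL ℝ p w).1)) p₀ :=
      ((g.contMDiff.contMDiffAt (x := p₀.1)).comp p₀ contMDiffAt_fst).clm_bundle_apply₂ (h1 v) (h1 w)
    have a2 : ContMDiffAt (I.prod I') (I'.prod 𝓘(ℝ, ℝ)) ∞ (fun p : M × M' =>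
       TotalSpace.mk' ℝ (E := Bundle.Trivial M' ℝ) p.2 (g'.inner p.2 (show E × E' from t.symmL ℝ p v).2 
        (show E × E' from t.symmL ℝ p w).2)) p₀ :=
      ((g'.contMDiff.contMDiffAt (x := p₀.2)).comp p₀ contMDiffAt_snd).clm_bundle_apply₂ (h2 v) (h2 w)
    simp only [contMDiffAt_totalSpace] at a1 a2
    exact a1.2.add a2.2
  refine key.congr_of_eventuallyEq ?_
  filter_upwards [t.open_baseSet.mem_nhds (mem_baseSet_trivializationAt _ _ p₀)] with p hp
  rw [inCoordinates_apply_eq₂ hp hp (Set.mem_univ _)]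
  rw [Trivialization.symmL_apply _ hp, Trivialization.symmL_apply _ hp]
  simp [t]
/-- The product metric `g + g'`. -/
def prodMetric (g : Metric I M) (g' : Metric I' M') : Metric (I.prod I') (M × M') where
  inner := prodInner g g'
  symm p v w := congrArg₂ (· + ·) (g.symm p.1 _ _) (g'.symm p.2 _ _)
  pos p v hv := by
    obtain ⟨v₁, v₂⟩ := v
    change 0 < g.inner p.1 v₁ v₁ + g'.inner p.2 v₂ v₂
    have nn₁ : 0 ≤ g.inner p.1 v₁ v₁ := by
      by_cases h : v₁ = 0
      · subst h; exact (congrFun (congrArg DFunLike.coe (map_zero (g.inner p.1))) _).ge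
      · exact (g.pos _ _ h).le
    have nn₂ : 0 ≤ g'.inner p.2 v₂ v₂ := by
      by_cases h : v₂ = 0
      · subst h; exact (congrFun (congrArg DFunLike.coe (map_zero (g'.inner p.2))) _).ge
      · exact (g'.pos _ _ h).le
    by_cases h : v₁ = 0
    · have h₂ : v₂ ≠ 0 := fun h₂ => hv (Prod.ext h h₂)
      exact add_pos_of_nonneg_of_pos nn₁ (g'.pos _ _ h₂)
    · exact add_pos_of_pos_of_nonneg (g.pos _ _ h) nn₂
  isVonNBounded p := by
    have nn₁ : ∀ v₁ : E, 0 ≤ g.inner p.1 v₁ v₁ := fun v₁ => by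
      by_cases h : v₁ = 0
      · subst h; exact (congrFun (congrArg DFunLike.coe (map_zero (g.inner p.1))) _).ge
      · exact (g.pos _ _ h).le
    have nn₂ : ∀ v₂ : E', 0 ≤ g'.inner p.2 v₂ v₂ := fun v₂ => by
      by_cases h : v₂ = 0
      · subst h; exact (congrFun (congrArg DFunLike.coe (map_zero (g'.inner p.2))) _).ge
      · exact (g'.pos _ _ h).le
    have b₁ : Bornology.IsVonNBounded ℝ {v : E | g.inner p.1 v v < 1} := g.isVonNBounded p.1
    have b₂ : Bornology.IsVonNBounded ℝ {v : E' | g'.inner p.2 v v < 1} := g'.isVonNBounded p.2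
    have b₁₂ : Bornology.IsVonNBounded ℝ
        ({v : E | g.inner p.1 v v < 1} ×ˢ {v : E' | g'.inner p.2 v v < 1}) := by
      rw [NormedSpace.isVonNBounded_iff] at *
      exact b₁.prod b₂
    refine b₁₂.subset ?_
    rintro ⟨v₁, v₂⟩ hv
    change g.inner p.1 v₁ v₁ + g'.inner p.2 v₂ v₂ < 1 at hv
    exact ⟨by have := nn₂ v₂; change g.inner p.1 v₁ v₁ < 1; linarith,
      by have := nn₁ v₁; change g'.inner p.2 v₂ v₂ < 1; linarith⟩
  contMDiff := prodInner_contMDiff g g'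

end Metric

/-- The negative definite quadratic form `v ↦ -|v|²` on `ℝⁿ`. -/
abbrev Q (n : ℕ) : QuadraticForm ℝ (Fin n → ℝ) :=
  QuadraticMap.weightedSumSquares ℝ (fun _ : Fin n => (-1 : ℝ))

/-- The real Clifford algebra `Cl(ℝⁿ)`, with `eᵢ² = -1` and `eᵢ eⱼ = - eⱼ eᵢ` for `i ≠ j`. -/
abbrev Cl (n : ℕ) := CliffordAlgebra (Q n)
/-- The complex Clifford algebra `Cl(ℝⁿ) ⊗ ℂ`. -/
abbrev ClC (n : ℕ) := ℂ ⊗[ℝ] Cl n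

/-- The group `Spin^c(n) = Spin(n) ×_{±1} S¹` is the set of the products `z ⊗ a` in `Cl(ℝⁿ) ⊗ ℂ` with
`z ∈ S¹` and `a ∈ Spin(n)`. `IsSpinCLift h A μ` says that `h = z ⊗ a` lies in `Spin^c(n)` and that
its image under the two-fold covering
`Spin^c(n) → SO(n) × S¹`, `z ⊗ a ↦ (v ↦ a v a⁻¹, z²)`, is `(A, μ)`
(for `a ∈ Spin(n)` the inverse of `a` is `star a`). -/
def IsSpinCLift {n : ℕ} (h : ClC n) (A : (Fin n → ℝ) →ₗ[ℝ] (Fin n → ℝ)) (μ : ℂ) : Prop :=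
  ∃ (z : ℂ) (a : Cl n), ‖z‖ = 1 ∧ a ∈ spinGroup (Q n) ∧ h = z ⊗ₜ a ∧
    (∀ v, a * CliffordAlgebra.ι (Q n) v * star a = CliffordAlgebra.ι (Q n) (A v)) ∧ μ = z ^ 2

/-- The isometric inclusion `ℝ^k₁ → ℝ^(k₁+k₂)` as the first `k₁` coordinates. -/
def inl (k₁ k₂ : ℕ) : Q k₁ →qᵢ Q (k₁ + k₂) where
  toFun x := Fin.append x 0
  map_add' x y := by
    ext i; refine Fin.addCases (fun i => ?_) (fun i => ?_) i <;> simp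
  map_smul' c x := by
    ext i; refine Fin.addCases (fun i => ?_) (fun i => ?_) i <;> simp
  map_app' x := by
    simp [Fin.sum_univ_add]

/-- The isometric inclusion `ℝ^k₂ → ℝ^(k₁+k₂)` as the last `k₂` coordinates. -/
def inr (k₁ k₂ : ℕ) : Q k₂ →qᵢ Q (k₁ + k₂) where
  toFun x := Fin.append 0 x
  map_add' x y := by
    ext i; refine Fin.addCases (fun i => ?_) (fun i => ?_) i <;> simp
  map_smul' c x := by
    ext i; refine Fin.addCases (fun i => ?_) (fun i => ?_) i <;> simp
  map_app' x := by
    simp [Fin.sum_univ_add]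

theorem inl_add_inr {k₁ k₂ : ℕ} (x : Fin k₁ → ℝ) (y : Fin k₂ → ℝ) :
    inl k₁ k₂ x + inr k₁ k₂ y = Fin.append x y := by
  ext i
  refine Fin.addCases (fun i => ?_) (fun i => ?_) i <;>
    simp [show ∀ z, inl k₁ k₂ z = Fin.append z 0 from fun _ => rfl,
      show ∀ z, inr k₁ k₂ z = Fin.append 0 z from fun _ => rfl]

theorem isOrtho_inl_inr (k₁ k₂ : ℕ) (x : Fin k₁ → ℝ) (y : Fin k₂ → ℝ) :
    (Q (k₁ + k₂)).IsOrtho (inl k₁ k₂ x) (inr k₁ k₂ y) := by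
  rw [QuadraticMap.isOrtho_def, inl_add_inr, (inl k₁ k₂).map_app, (inr k₁ k₂).map_app]
  simp [Fin.sum_univ_add, add_comm]

section spinmap
variable {m n : ℕ} (f : Q m →qᵢ Q n)

theorem involute_map (a : Cl m) :
    CliffordAlgebra.involute (CliffordAlgebra.map f a) =
      CliffordAlgebra.map f (CliffordAlgebra.involute a) := by
  have : (CliffordAlgebra.involute.comp (CliffordAlgebra.map f)) =
      (CliffordAlgebra.map f).comp CliffordAlgebra.involute := by
    ext; simp
  exact congrArg (fun φ => φ a) this

theorem reverse_map (a : Cl m) :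
    CliffordAlgebra.reverse (CliffordAlgebra.map f a) =
      CliffordAlgebra.map f (CliffordAlgebra.reverse a) := by
  induction a using CliffordAlgebra.induction with
  | algebraMap r => simp
  | ι v => simp
  | mul a b ha hb => simp [ha, hb]
  | add a b ha hb => simp [ha, hb]

theorem star_map (a : Cl m) :
    star (CliffordAlgebra.map f a) = CliffordAlgebra.map f (star a) := by
  rw [CliffordAlgebra.star_def, CliffordAlgebra.star_def, involute_map, reverse_map]

theorem map_mem_even {a : Cl m} (ha : a ∈ CliffordAlgebra.evenOdd (Q m) 0) :
    CliffordAlgebra.map f a ∈ CliffordAlgebra.evenOdd (Q n) 0 := by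
  induction a, ha using CliffordAlgebra.even_induction with
  | algebraMap r =>
    rw [AlgHom.commutes]
    exact SetLike.algebraMap_mem_graded _ _
  | add x y _ _ hx hy => rw [map_add]; exact Submodule.add_mem _ hx hy
  | ι_mul_ι_mul v w x _ hx =>
    rw [map_mul, map_mul, CliffordAlgebra.map_apply_ι, CliffordAlgebra.map_apply_ι]
    have := SetLike.mul_mem_graded
      (CliffordAlgebra.ι_mul_ι_mem_evenOdd_zero (Q n) (f v) (f w)) hx
    rwa [zero_add] at this

theorem map_mem_spinGroup {a : Cl m} (ha : a ∈ spinGroup (Q m)) :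
    CliffordAlgebra.map f a ∈ spinGroup (Q n) := by
  refine ⟨⟨?_, ?_⟩, ?_⟩
  · obtain ⟨u, hu, rfl⟩ := ha.1.1
    refine ⟨Units.map (CliffordAlgebra.map f : Cl m →* Cl n) u, ?_, rfl⟩
    have : lipschitzGroup (Q m) ≤ (lipschitzGroup (Q n)).comap
        (Units.map (CliffordAlgebra.map f : Cl m →* Cl n)) := by
      refine (Subgroup.closure_le _).2 ?_
      rintro v ⟨w, hw⟩
      refine Subgroup.subset_closure ⟨f w, ?_⟩
      simp [← hw]
    exact this hu
  · change CliffordAlgebra.map f a ∈ unitary (Cl n)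
    rw [Unitary.mem_iff, star_map, ← map_mul, ← map_mul,
      spinGroup.star_mul_self_of_mem ha, spinGroup.mul_star_self_of_mem ha, map_one]
    exact ⟨rfl, rfl⟩
  · exact map_mem_even f ha.2
end spinmap

theorem isSpinCLift_mul {k₁ k₂ : ℕ} {h₁ : ClC k₁} {h₂ : ClC k₂}
    {A₁ : (Fin k₁ → ℝ) →ₗ[ℝ] (Fin k₁ → ℝ)} {A₂ : (Fin k₂ → ℝ) →ₗ[ℝ] (Fin k₂ → ℝ)}
    {A : (Fin (k₁ + k₂) → ℝ) →ₗ[ℝ] (Fin (k₁ + k₂) → ℝ)} {μ₁ μ₂ : ℂ}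
    (H₁ : IsSpinCLift h₁ A₁ μ₁) (H₂ : IsSpinCLift h₂ A₂ μ₂)
    (hA : ∀ v w, A (Fin.append v w) = Fin.append (A₁ v) (A₂ w)) :
    IsSpinCLift (Algebra.TensorProduct.map (AlgHom.id ℂ ℂ) (CliffordAlgebra.map (inl k₁ k₂)) h₁ *
      Algebra.TensorProduct.map (AlgHom.id ℂ ℂ) (CliffordAlgebra.map (inr k₁ k₂)) h₂) A
      (μ₁ * μ₂) := by
  obtain ⟨z₁, a₁, hz₁, ha₁, rfl, hv₁, rfl⟩ := H₁
  obtain ⟨z₂, a₂, hz₂, ha₂, rfl, hv₂, rfl⟩ := H₂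
  set j₁ := CliffordAlgebra.map (inl k₁ k₂) with hj₁
  set j₂ := CliffordAlgebra.map (inr k₁ k₂) with hj₂
  have ho := isOrtho_inl_inr k₁ k₂
  have c₁ : ∀ v, Commute (j₁ a₁) (CliffordAlgebra.ι (Q (k₁ + k₂)) (inr k₁ k₂ v)) := fun v => by
    rw [← CliffordAlgebra.map_apply_ι (inr k₁ k₂) v]
    exact CliffordAlgebra.commute_map_mul_map_of_isOrtho_of_mem_evenOdd_zero_left _ _ ho _ _
      ha₁.2 (CliffordAlgebra.ι_mem_evenOdd_one (Q k₂) v)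
  have c₂ : ∀ v, Commute (CliffordAlgebra.ι (Q (k₁ + k₂)) (inl k₁ k₂ v)) (j₂ a₂) := fun v => by
    rw [← CliffordAlgebra.map_apply_ι (inl k₁ k₂) v]
    exact CliffordAlgebra.commute_map_mul_map_of_isOrtho_of_mem_evenOdd_zero_right _ _ ho _ _
      (CliffordAlgebra.ι_mem_evenOdd_one (Q k₁) v) ha₂.2
  have u₁ : j₁ a₁ * star (j₁ a₁) = 1 := spinGroup.mul_star_self_of_mem (map_mem_spinGroup _ ha₁)
  have u₂ : j₂ a₂ * star (j₂ a₂) = 1 := spinGroup.mul_star_self_of_mem (map_mem_spinGroup _ ha₂)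
  have w₁ : ∀ v, j₁ a₁ * CliffordAlgebra.ι _ (inl k₁ k₂ v) * star (j₁ a₁) =
      CliffordAlgebra.ι _ (inl k₁ k₂ (A₁ v)) := fun v => by
    rw [← CliffordAlgebra.map_apply_ι, ← CliffordAlgebra.map_apply_ι, ← hv₁, star_map, map_mul,
      map_mul]
  have w₂ : ∀ v, j₂ a₂ * CliffordAlgebra.ι _ (inr k₁ k₂ v) * star (j₂ a₂) =
      CliffordAlgebra.ι _ (inr k₁ k₂ (A₂ v)) := fun v => by
    rw [← CliffordAlgebra.map_apply_ι, ← CliffordAlgebra.map_apply_ι, ← hv₂, star_map, map_mul,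
      map_mul]
  refine ⟨z₁ * z₂, j₁ a₁ * j₂ a₂, by simp [hz₁, hz₂],
    mul_mem (map_mem_spinGroup _ ha₁) (map_mem_spinGroup _ ha₂), by simp [hj₁, hj₂], ?_, by ring⟩
  intro v
  obtain ⟨x, y, rfl⟩ : ∃ x y, Fin.append x y = v := ⟨_, _, Fin.append_castAdd_natAdd⟩
  rw [hA, ← inl_add_inr, ← inl_add_inr, map_add, map_add, mul_add, add_mul, star_mul]
  congr 1
  · rw [mul_assoc (j₁ a₁), ← (c₂ x).eq, ← mul_assoc (j₁ a₁), mul_assoc, ← mul_assoc (j₂ a₂),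
      u₂, one_mul, w₁]
  · rw [← w₂, mul_assoc (j₁ a₁), ← mul_assoc _ (star (j₂ a₂)), mul_assoc (j₁ a₁), w₂,
      (c₁ _).eq, mul_assoc, u₁, mul_one]

theorem commute_of_isSpinCLift {k₁ k₂ : ℕ} {h₁ : ClC k₁} {h₂ : ClC k₂}
    {A₁ : (Fin k₁ → ℝ) →ₗ[ℝ] (Fin k₁ → ℝ)} {A₂ : (Fin k₂ → ℝ) →ₗ[ℝ] (Fin k₂ → ℝ)} {μ₁ μ₂ : ℂ}
    (H₁ : IsSpinCLift h₁ A₁ μ₁) (H₂ : IsSpinCLift h₂ A₂ μ₂) :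
    Commute (Algebra.TensorProduct.map (AlgHom.id ℂ ℂ) (CliffordAlgebra.map (inl k₁ k₂)) h₁)
      (Algebra.TensorProduct.map (AlgHom.id ℂ ℂ) (CliffordAlgebra.map (inr k₁ k₂)) h₂) := by
  obtain ⟨z₁, a₁, -, ha₁, rfl, -, -⟩ := H₁
  obtain ⟨z₂, a₂, -, ha₂, rfl, -, -⟩ := H₂
  have := (CliffordAlgebra.commute_map_mul_map_of_isOrtho_of_mem_evenOdd_zero_left
    (inl k₁ k₂) (inr k₁ k₂) (isOrtho_inl_inr k₁ k₂) a₁ a₂ ha₁.2 ha₂.2).eq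
  simp [Commute, SemiconjBy, this, mul_comm z₁]

/-- A spinor module `Δₙ`: an irreducible complex module over the Clifford algebra `Cl(ℝⁿ)` (it has
dimension `2^[n/2]`, is unique up to isomorphism for even `n`, and there are two of them for odd `n`).
The Hermitian inner product of `F` only serves to give `F` and the bundles built from it a norm. -/
structure SpinorModule (n : ℕ) (F : Type*) [NormedAddCommGroup F] [InnerProductSpace ℂ F] where
  /-- the module structure -/
  clifford : Cl n →ₐ[ℝ] Module.End ℂ F
  nontrivial : Nontrivial F
  irreducible : ∀ W : Submodule ℂ F,
    (∀ v, ∀ s ∈ W, clifford (CliffordAlgebra.ι (Q n) v) s ∈ W) → W = ⊥ ∨ W = ⊤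


variable {n : ℕ} {F : Type*} [NormedAddCommGroup F] [InnerProductSpace ℂ F]

namespace SpinorModule

/-- The action of the complex Clifford algebra on a spinor module. -/
def action (S : SpinorModule n F) : ClC n →ₐ[ℂ] Module.End ℂ F :=
  Algebra.TensorProduct.lift (Algebra.ofId ℂ (Module.End ℂ F)) S.clifford
    fun c a => Algebra.commutes c (S.clifford a)

/-- Clifford multiplication by the volume element `e₁ ⋯ eₙ`. -/
def vol (S : SpinorModule n F) : Module.End ℂ F :=
  S.clifford (List.ofFn fun l : Fin n => CliffordAlgebra.ι (Q n) (Pi.single l 1)).prod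

/-- For odd `n = 2q+1`: the volume element acts as the scalar `ε (√-1)^(q+1)`, `ε = ±1`. The module
`Δₙ'` is the one with `ε = 1` and `Δₙ''` the one with `ε = -1`. -/
def HasSign (S : SpinorModule n F) (ε : ℤˣ) : Prop :=
  S.vol = (((ε : ℤ) : ℂ) * Complex.I ^ ((n + 1) / 2)) • (1 : Module.End ℂ F)

end SpinorModule

section SpinC
variable {E H M : Type*} [NormedAddCommGroup E] [NormedSpace ℝ E]
  [TopologicalSpace H] [TopologicalSpace M] [ChartedSpace H M]
  {E' H' M' : Type*} [NormedAddCommGroup E'] [NormedSpace ℝ E']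
  [TopologicalSpace H'] [TopologicalSpace M'] [ChartedSpace H' M']
  {I : ModelWithCorners ℝ E H} {I' : ModelWithCorners ℝ E' H'}
  {C : Type*} [NormedAddCommGroup C] [InnerProductSpace ℂ C]
  {C' : Type*} [NormedAddCommGroup C'] [InnerProductSpace ℂ C']
  {ι ι' : Type*} 

/-- A map into a real vector space is smooth on `s` if it is a finite linear combination of
constant vectors with smooth coefficients. -/
def SmoothInto (I : ModelWithCorners ℝ E H) {V : Type*} [AddCommGroup V] [Module ℝ V]
    (f : M → V) (s : Set M) : Prop :=
  ∃ (κ : Type) (_ : Fintype κ) (c : κ → V) (a : κ → M → ℝ),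
    (∀ k, ContMDiffOn I 𝓘(ℝ, ℝ) ∞ (a k) s) ∧ ∀ x ∈ s, f x = ∑ k, a k x • c k

theorem SmoothInto.linear {V W : Type*} [AddCommGroup V] [Module ℝ V] [NormedAddCommGroup W]
    [NormedSpace ℝ W] {f : M → V} {s : Set M} (hf : SmoothInto I f s) (L : V →ₗ[ℝ] W) :
    ContMDiffOn I 𝓘(ℝ, W) ∞ (fun x => L (f x)) s := by
  obtain ⟨κ, _, c, a, ha, h⟩ := hf
  have : ContMDiffOn I 𝓘(ℝ, W) ∞ (fun x => ∑ k, a k x • L (c k)) s :=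
    contMDiffOn_finsetSum fun k _ => (ha k).smul contMDiffOn_const
  exact this.congr fun x hx => by simp [h x hx]

theorem SmoothInto.bilinear {V V' W : Type*} [AddCommGroup V] [Module ℝ V] [AddCommGroup V']
    [Module ℝ V'] [AddCommGroup W] [Module ℝ W] {f : M → V} {f' : M' → V'} {s : Set M}
    {s' : Set M'} (hf : SmoothInto I f s) (hf' : SmoothInto I' f' s') (L : V →ₗ[ℝ] V' →ₗ[ℝ] W)
    {t : Set (M × M')} (ht : ∀ p ∈ t, p.1 ∈ s ∧ p.2 ∈ s') :
    SmoothInto (I.prod I') (fun p : M × M' => L (f p.1) (f' p.2)) t := by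
  obtain ⟨κ, _, c, a, ha, h⟩ := hf
  obtain ⟨κ', _, c', a', ha', h'⟩ := hf'
  refine ⟨κ × κ', inferInstance, fun k => L (c k.1) (c' k.2), fun k p => a k.1 p.1 * a' k.2 p.2,
    fun k => ?_, fun p hp => ?_⟩
  · exact ((ha k.1).comp contMDiffOn_fst fun p hp => (ht p hp).1).mul
      ((ha' k.2).comp contMDiffOn_snd fun p hp => (ht p hp).2)
  · simp only [h p.1 (ht p hp).1, h' p.2 (ht p hp).2, map_sum, map_smul, LinearMap.sum_apply,
      LinearMap.smul_apply, Fintype.sum_prod_type, Finset.smul_sum, smul_smul]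
    rw [Finset.sum_comm]
    simp only [mul_comm]

/-- A `Spin^c` structure on a Riemannian `n`-manifold `(M, g)` with associated complex line bundle
`L`, described by transition functions over an open cover over which `L` is trivialised: smooth
orthonormal frames on the members of the cover, whose transition functions lie in `SO(n)` (so that
they orient `M`), and a smooth `Spin^c(n)`-valued cocycle which lifts the transition functions
of (oriented orthonormal frames) `×` (unit vectors of `L`) through the two-fold covering
`Spin^c(n) → SO(n) × S¹`.

All cocycles are written so that the index pair `i j` stands for the change from the coordinates
over the `i`-th set to the coordinates over the `j`-th set. The values of `frame i` and `trans i j`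
outside the `i`-th set, and outside the intersection of the `i`-th and `j`-th sets, are irrelevant. -/
structure SpinCStructure [IsManifold I ∞ M] (g : Metric I M) (L : SmoothBundle I M C ι)
    (n : ℕ) where
  finrank_fibre : Module.finrank ℂ C = 1
  frame : ι → ∀ x : M, Module.Basis (Fin n) ℝ (TangentSpace I x)
  frame_orthonormal : ∀ i, ∀ x ∈ L.baseSet i, ∀ k l,
    g.inner x (frame i x k) (frame i x l) = if k = l then 1 else 0
  frame_smooth : ∀ i k, ContMDiffOn I I.tangent ∞
    (fun x => (⟨x, frame i x k⟩ : TangentBundle I M)) (L.baseSet i)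
  trans : ι → ι → M → ClC n
  trans_smooth : ∀ i j, SmoothInto I (trans i j) (L.baseSet i ∩ L.baseSet j)
  trans_self : ∀ i, ∀ x ∈ L.baseSet i, trans i i x = 1
  trans_comp : ∀ i j k, ∀ x ∈ L.baseSet i ∩ L.baseSet j ∩ L.baseSet k,
    trans j k x * trans i j x = trans i k x
  isLift : ∀ i j, ∀ x ∈ L.baseSet i ∩ L.baseSet j, ∃ μ : ℂ,
    IsSpinCLift (trans i j x)
      ((frame i x).equivFun.symm.trans (frame j x).equivFun : (Fin n → ℝ) →ₗ[ℝ] (Fin n → ℝ)) μ ∧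
    ∀ c : C, L.coordChange i j x c = μ • c

namespace SpinCStructure

section spinor
variable [IsManifold I ∞ M] {g : Metric I M} {L : SmoothBundle I M C ι}
  [FiniteDimensional ℂ F] (𝔰 : SpinCStructure g L n) (S : SpinorModule n F)

/-- The spinor bundle: the vector bundle with fibre the spinor module `S` associated to the
principal `Spin^c(n)` bundle. -/
def spinorBundle : SmoothBundle I M F ι :=
  have sm : ∀ i j, ContMDiffOn I 𝓘(ℝ, F →L[ℂ] F) ∞
      (fun x => LinearMap.toContinuousLinearMap (S.action (𝔰.trans i j x)))
      (L.baseSet i ∩ L.baseSet j) := fun i j =>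
    (𝔰.trans_smooth i j).linear
      ((LinearMap.toContinuousLinearMap.toLinearMap : (F →ₗ[ℂ] F) →ₗ[ℂ] (F →L[ℂ] F)).restrictScalars
        ℝ ∘ₗ S.action.toLinearMap.restrictScalars ℝ)
  { baseSet := L.baseSet
    isOpen_baseSet := L.isOpen_baseSet
    indexAt := L.indexAt
    mem_baseSet_at := L.mem_baseSet_at
    coordChange := fun i j x => LinearMap.toContinuousLinearMap (S.action (𝔰.trans i j x))
    coordChange_self := fun i x hx v => by simp [𝔰.trans_self i x hx]
    continuousOn_coordChange := fun i j => (sm i j).continuousOn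
    coordChange_comp := fun i j k x hx v => by
      simp [← 𝔰.trans_comp i j k x hx]
    smooth_coordChange := sm }

/-- Clifford multiplication `v · ψ` of spinors at `x` by tangent vectors at `x`. -/
def cliffordMul (x : M) :
    TangentSpace I x →ₗ[ℝ] Module.End ℂ ((𝔰.spinorBundle S).Fiber x) :=
  show TangentSpace I x →ₗ[ℝ] Module.End ℂ F from
    S.clifford.toLinearMap ∘ₗ CliffordAlgebra.ι (Q n) ∘ₗ
      ((𝔰.frame (L.indexAt x) x).equivFun : TangentSpace I x →ₗ[ℝ] (Fin n → ℝ))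

/-- Clifford multiplication does not depend on the local trivialisation it is computed in. -/
theorem coordChange_comp_clifford {i j : ι} {x : M} (hx : x ∈ L.baseSet i ∩ L.baseSet j)
    (v : TangentSpace I x) (s : F) :
    (𝔰.spinorBundle S).coordChange i j x
        (S.clifford (CliffordAlgebra.ι (Q n) ((𝔰.frame i x).equivFun v)) s) =
      S.clifford (CliffordAlgebra.ι (Q n) ((𝔰.frame j x).equivFun v))
        ((𝔰.spinorBundle S).coordChange i j x s) := by
  obtain ⟨μ, ⟨z, a, hz, ha, h, hv, -⟩, -⟩ := 𝔰.isLift i j x hx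
  have hw := hv ((𝔰.frame i x).equivFun v)
  simp only [LinearEquiv.coe_coe, LinearEquiv.trans_apply, LinearEquiv.symm_apply_apply] at hw
  have hS : S.action (z ⊗ₜ a) = z • S.clifford a := by
    refine (Algebra.TensorProduct.lift_tmul _ _ _ _ _).trans ?_
    rw [Algebra.ofId_apply, Algebra.smul_def]
  change S.action (𝔰.trans i j x) _ = S.clifford _ (S.action (𝔰.trans i j x) _)
  rw [h, hS, ← hw, map_mul, map_mul]
  simp only [Module.End.mul_apply, LinearMap.smul_apply, map_smul]
  rw [← Module.End.mul_apply (S.clifford (star a)), ← map_mul,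
    spinGroup.star_mul_self_of_mem ha, map_one, Module.End.one_apply]

/-- The action `E₁ · E₂ ⋯ Eₙ ·` of the volume form on spinors, `E` an oriented orthonormal frame. -/
def volMul (x : M) : Module.End ℂ ((𝔰.spinorBundle S).Fiber x) :=
  (List.ofFn fun l => 𝔰.cliffordMul S x (𝔰.frame (L.indexAt x) x l)).prod

end spinor

section prod
variable [FiniteDimensional ℝ E] [FiniteDimensional ℝ E'] [IsManifold I ∞ M] [IsManifold I' ∞ M']
  [FiniteDimensional ℂ C] [FiniteDimensional ℂ C']
  {g : Metric I M} {g' : Metric I' M'} {L : SmoothBundle I M C ι} {L' : SmoothBundle I' M' C' ι'}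
  {k₁ k₂ : ℕ}

/-- The basis `(E₁, …, E_k₁, F₁, …, F_k₂)` of `T_(x,y)(M × M')`. -/
def prodBasis {x : M} {y : M'} (b : Module.Basis (Fin k₁) ℝ (TangentSpace I x))
    (b' : Module.Basis (Fin k₂) ℝ (TangentSpace I' y)) :
    Module.Basis (Fin (k₁ + k₂)) ℝ (TangentSpace (I.prod I') (x, y)) :=
  show Module.Basis (Fin (k₁ + k₂)) ℝ (TangentSpace I x × TangentSpace I' y) from
    (b.prod b').reindex finSumFinEquiv

theorem prodBasis_castAdd {x : M} {y : M'} (b : Module.Basis (Fin k₁) ℝ (TangentSpace I x))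
    (b' : Module.Basis (Fin k₂) ℝ (TangentSpace I' y)) (k : Fin k₁) :
    prodBasis b b' (Fin.castAdd k₂ k) = ((b k, 0) : TangentSpace I x × TangentSpace I' y) := by
  change ((b.prod b').reindex finSumFinEquiv) _ = _
  apply Prod.ext <;> simp

theorem prodBasis_natAdd {x : M} {y : M'} (b : Module.Basis (Fin k₁) ℝ (TangentSpace I x))
    (b' : Module.Basis (Fin k₂) ℝ (TangentSpace I' y)) (k : Fin k₂) :
    prodBasis b b' (Fin.natAdd k₁ k) = ((0, b' k) : TangentSpace I x × TangentSpace I' y) := by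
  change ((b.prod b').reindex finSumFinEquiv) _ = _
  apply Prod.ext <;> simp

theorem prodBasis_equivFun {x : M} {y : M'} (b : Module.Basis (Fin k₁) ℝ (TangentSpace I x))
    (b' : Module.Basis (Fin k₂) ℝ (TangentSpace I' y)) (v : TangentSpace I x)
    (w : TangentSpace I' y) :
    (prodBasis b b').equivFun ((v, w) : TangentSpace I x × TangentSpace I' y) =
      Fin.append (b.equivFun v) (b'.equivFun w) := by
  change ((b.prod b').reindex finSumFinEquiv).equivFun _ = _
  ext i
  refine Fin.addCases (fun i => ?_) (fun i => ?_) i <;> simp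

/-- The product `Spin^c` structure on `(M × M', g + g')`, with line bundle `π₁^*L ⊗ π₂^*L'`: the
extension of the structure group along
`Spin^c(k₁) ×_{S¹} Spin^c(k₂) → Spin^c(k₁+k₂)`, `(h₁, h₂) ↦ h₁ h₂`. -/
def prod (𝔰₁ : SpinCStructure g L k₁) (𝔰₂ : SpinCStructure g' L' k₂) :
    SpinCStructure (prodMetric g g') (L.boxTensor L') (k₁ + k₂) where
  finrank_fibre := by
    rw [Module.finrank_tensorProduct, 𝔰₁.finrank_fibre, 𝔰₂.finrank_fibre]
  frame i p := prodBasis (𝔰₁.frame i.1 p.1) (𝔰₂.frame i.2 p.2)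
  frame_orthonormal i p hp k l := by
    have key : ∀ v w : TangentSpace (I.prod I') p, (prodMetric g g').inner p v w =
        g.inner p.1 (show E × E' from v).1 (show E × E' from w).1 +
          g'.inner p.2 (show E × E' from v).2 (show E × E' from w).2 := fun _ _ => rfl
    have z₁ : ∀ v, g.inner p.1 v 0 = 0 := fun v => map_zero (g.inner p.1 v)
    have z₂ : ∀ v, g'.inner p.2 v 0 = 0 := fun v => map_zero (g'.inner p.2 v)
    have z₃ : ∀ v, g.inner p.1 0 v = 0 := fun v => by rw [g.symm, z₁]
    have z₄ : ∀ v, g'.inner p.2 0 v = 0 := fun v => by rw [g'.symm, z₂]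
    have o₁ := 𝔰₁.frame_orthonormal i.1 p.1 hp.1
    have o₂ := 𝔰₂.frame_orthonormal i.2 p.2 hp.2
    rw [key]
    refine Fin.addCases (fun k => ?_) (fun k => ?_) k <;>
      refine Fin.addCases (fun l => ?_) (fun l => ?_) l
    · rw [prodBasis_castAdd, prodBasis_castAdd]
      refine (congrArg₂ (· + ·) (o₁ k l) (z₂ 0)).trans ?_
      simp
    · rw [prodBasis_castAdd, prodBasis_natAdd]
      refine (congrArg₂ (· + ·) (z₁ _) (z₄ _)).trans ?_
      simp [Fin.ext_iff]; omega
    · rw [prodBasis_natAdd, prodBasis_castAdd]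
      refine (congrArg₂ (· + ·) (z₃ _) (z₂ _)).trans ?_
      simp [Fin.ext_iff]; omega
    · rw [prodBasis_natAdd, prodBasis_natAdd]
      refine (congrArg₂ (· + ·) (z₁ 0) (o₂ k l)).trans ?_
      simp
  frame_smooth i k := by
    have e := (contMDiff_equivTangentBundleProd_symm (I := I) (I' := I') (M := M) (M' := M')
      (n := ∞))
    have zE : ContMDiff I I.tangent ∞ (fun x : M => (⟨x, 0⟩ : TangentBundle I M)) :=
      contMDiff_zeroSection ℝ (TangentSpace I : M → Type _)
    have zE' : ContMDiff I' I'.tangent ∞ (fun x : M' => (⟨x, 0⟩ : TangentBundle I' M')) :=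
      contMDiff_zeroSection ℝ (TangentSpace I' : M' → Type _)
    refine Fin.addCases (fun k => ?_) (fun k => ?_) k
    · exact (e.comp_contMDiffOn
        (((𝔰₁.frame_smooth i.1 k).comp contMDiffOn_fst fun p hp => hp.1).prodMk
          (zE'.comp contMDiff_snd).contMDiffOn)).congr fun p _ =>
        congrArg (TotalSpace.mk p) (prodBasis_castAdd _ _ _)
    · exact (e.comp_contMDiffOn
        ((zE.comp contMDiff_fst).contMDiffOn.prodMk
          ((𝔰₂.frame_smooth i.2 k).comp contMDiffOn_snd fun p hp => hp.2))).congr fun p _ =>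
        congrArg (TotalSpace.mk p) (prodBasis_natAdd _ _ _)
  trans i j p :=
    Algebra.TensorProduct.map (AlgHom.id ℂ ℂ) (CliffordAlgebra.map (inl k₁ k₂))
        (𝔰₁.trans i.1 j.1 p.1) *
      Algebra.TensorProduct.map (AlgHom.id ℂ ℂ) (CliffordAlgebra.map (inr k₁ k₂))
        (𝔰₂.trans i.2 j.2 p.2)
  trans_smooth i j :=
    (𝔰₁.trans_smooth i.1 j.1).bilinear (𝔰₂.trans_smooth i.2 j.2)
      ((LinearMap.mul ℝ (ClC (k₁ + k₂))).compl₁₂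
        ((Algebra.TensorProduct.map (AlgHom.id ℂ ℂ)
          (CliffordAlgebra.map (inl k₁ k₂))).toLinearMap.restrictScalars ℝ)
        ((Algebra.TensorProduct.map (AlgHom.id ℂ ℂ)
          (CliffordAlgebra.map (inr k₁ k₂))).toLinearMap.restrictScalars ℝ))
      fun p hp => ⟨⟨hp.1.1, hp.2.1⟩, ⟨hp.1.2, hp.2.2⟩⟩
  trans_self i p hp := by
    rw [𝔰₁.trans_self _ _ hp.1, 𝔰₂.trans_self _ _ hp.2, map_one, map_one, one_mul]
  trans_comp i j k p hp := by
    obtain ⟨_, h₁, -⟩ := 𝔰₁.isLift i.1 j.1 p.1 ⟨hp.1.1.1, hp.1.2.1⟩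
    obtain ⟨_, h₂, -⟩ := 𝔰₂.isLift j.2 k.2 p.2 ⟨hp.1.2.2, hp.2.2⟩
    rw [← 𝔰₁.trans_comp i.1 j.1 k.1 p.1 ⟨⟨hp.1.1.1, hp.1.2.1⟩, hp.2.1⟩,
      ← 𝔰₂.trans_comp i.2 j.2 k.2 p.2 ⟨⟨hp.1.1.2, hp.1.2.2⟩, hp.2.2⟩, map_mul, map_mul]
    exact (commute_of_isSpinCLift h₁ h₂).symm.mul_mul_mul_comm _ _
  isLift i j p hp := by
    obtain ⟨μ₁, h₁, hL₁⟩ := 𝔰₁.isLift i.1 j.1 p.1 ⟨hp.1.1, hp.2.1⟩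
    obtain ⟨μ₂, h₂, hL₂⟩ := 𝔰₂.isLift i.2 j.2 p.2 ⟨hp.1.2, hp.2.2⟩
    refine ⟨μ₁ * μ₂, isSpinCLift_mul h₁ h₂ fun v w => ?_, fun c => ?_⟩
    · have hv : Fin.append v w = (prodBasis (𝔰₁.frame i.1 p.1) (𝔰₂.frame i.2 p.2)).equivFun
          (((𝔰₁.frame i.1 p.1).equivFun.symm v, (𝔰₂.frame i.2 p.2).equivFun.symm w) :
            TangentSpace I p.1 × TangentSpace I' p.2) := by
        rw [prodBasis_equivFun, LinearEquiv.apply_symm_apply, LinearEquiv.apply_symm_apply]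
      simp only [LinearEquiv.coe_coe, LinearEquiv.trans_apply]
      rw [hv]
      erw [LinearEquiv.symm_apply_apply]
      exact prodBasis_equivFun _ _ _ _
    · change TensorProduct.mapL (L.coordChange i.1 j.1 p.1) (L'.coordChange i.2 j.2 p.2) c = _
      induction c using TensorProduct.induction_on with
      | zero => simp
      | tmul c c' => rw [TensorProduct.mapL_tmul, hL₁, hL₂, TensorProduct.smul_tmul_smul]
      | add c c' hc hc' => rw [map_add, hc, hc', smul_add]

end prod

section actions
variable [IsManifold I ∞ M] [IsManifold I' ∞ M']
  {g : Metric I M} {g' : Metric I' M'} {L : SmoothBundle I M C ι} {L' : SmoothBundle I' M' C' ι'}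
  {k₁ k₂ : ℕ} {F₁ F₁' F₂ : Type*}
  [NormedAddCommGroup F₁] [InnerProductSpace ℂ F₁] [FiniteDimensional ℂ F₁]
  [NormedAddCommGroup F₁'] [InnerProductSpace ℂ F₁'] [FiniteDimensional ℂ F₁']
  [NormedAddCommGroup F₂] [InnerProductSpace ℂ F₂] [FiniteDimensional ℂ F₂]
  (𝔰₁ : SpinCStructure g L k₁) (𝔰₂ : SpinCStructure g' L' k₂)
  (S₁ : SpinorModule k₁ F₁) (S₁' : SpinorModule k₁ F₁') (S₂ : SpinorModule k₂ F₂)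

/-- Clifford multiplication on `π₁^*Σ₁ ⊗ π₂^*Σ₂` for `k₁ = 2p`: a tangent vector `(v₁, v₂)` acts by
`φ₁ ⊗ φ₂ ↦ v₁ · φ₁ ⊗ φ₂ + (√-1)^p μ₁ · φ₁ ⊗ v₂ · φ₂`. -/
def leftEvenMul (p : ℕ) (x : M × M') (v : TangentSpace (I.prod I') x) :
    Module.End ℂ (((𝔰₁.spinorBundle S₁).boxTensor (𝔰₂.spinorBundle S₂)).Fiber x) :=
  let v' : TangentSpace I x.1 × TangentSpace I' x.2 := v
  let c₁ : F₁ →ₗ[ℂ] F₁ := 𝔰₁.cliffordMul S₁ x.1 v'.1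
  let μ₁ : F₁ →ₗ[ℂ] F₁ := 𝔰₁.volMul S₁ x.1
  let c₂ : F₂ →ₗ[ℂ] F₂ := 𝔰₂.cliffordMul S₂ x.2 v'.2
  show (F₁ ⊗[ℂ] F₂) →ₗ[ℂ] (F₁ ⊗[ℂ] F₂) from
    TensorProduct.map c₁ LinearMap.id + Complex.I ^ p • TensorProduct.map μ₁ c₂

/-- Clifford multiplication on `π₁^*Σ₁ ⊗ π₂^*Σ₂` for `k₂ = 2p`: a tangent vector `(v₁, v₂)` acts by
`φ₁ ⊗ φ₂ ↦ v₁ · φ₁ ⊗ (√-1)^p μ₂ · φ₂ + φ₁ ⊗ v₂ · φ₂`. -/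
def rightEvenMul (p : ℕ) (x : M × M') (v : TangentSpace (I.prod I') x) :
    Module.End ℂ (((𝔰₁.spinorBundle S₁).boxTensor (𝔰₂.spinorBundle S₂)).Fiber x) :=
  let v' : TangentSpace I x.1 × TangentSpace I' x.2 := v
  let c₁ : F₁ →ₗ[ℂ] F₁ := 𝔰₁.cliffordMul S₁ x.1 v'.1
  let c₂ : F₂ →ₗ[ℂ] F₂ := 𝔰₂.cliffordMul S₂ x.2 v'.2
  let μ₂ : F₂ →ₗ[ℂ] F₂ := 𝔰₂.volMul S₂ x.2
  show (F₁ ⊗[ℂ] F₂) →ₗ[ℂ] (F₁ ⊗[ℂ] F₂) from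
    Complex.I ^ p • TensorProduct.map c₁ μ₂ + TensorProduct.map LinearMap.id c₂

/-- The endomorphism `(φ', φ'') ↦ (j φ'', j⁻¹ φ')` of `F ⊕ F'`. -/
def swapMap {F F' : Type*} [NormedAddCommGroup F] [InnerProductSpace ℂ F]
    [NormedAddCommGroup F'] [InnerProductSpace ℂ F'] (j : F' ≃L[ℂ] F) :
    WithLp 2 (F × F') →ₗ[ℂ] WithLp 2 (F × F') :=
  (WithLp.linearEquiv 2 ℂ (F × F')).symm.toLinearMap ∘ₗ
    ((j : F' →ₗ[ℂ] F) ∘ₗ LinearMap.snd ℂ F F').prod ((j.symm : F →ₗ[ℂ] F') ∘ₗ LinearMap.fst ℂ F F')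
      ∘ₗ (WithLp.linearEquiv 2 ℂ (F × F')).toLinearMap

/-- Clifford multiplication on `(π₁^*Σ₁' ⊕ π₁^*Σ₁'') ⊗ π₂^*Σ₂`, where `J : Σ₁'' → Σ₁'` is an
isomorphism of vector bundles: a tangent vector `(v₁, v₂)` acts by
`(φ', φ'') ⊗ φ₂ ↦ (v₁ · φ', v₁ · φ'') ⊗ φ₂ + (J φ'', J⁻¹ φ') ⊗ v₂ · φ₂`. -/
def oddMul (J : BundleIso (𝔰₁.spinorBundle S₁') (𝔰₁.spinorBundle S₁)) (x : M × M')
    (v : TangentSpace (I.prod I') x) :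
    Module.End ℂ ((((𝔰₁.spinorBundle S₁).directSum (𝔰₁.spinorBundle S₁')).boxTensor
      (𝔰₂.spinorBundle S₂)).Fiber x) :=
  let v' : TangentSpace I x.1 × TangentSpace I' x.2 := v
  let c₁ : F₁ →ₗ[ℂ] F₁ := 𝔰₁.cliffordMul S₁ x.1 v'.1
  let c₁' : F₁' →ₗ[ℂ] F₁' := 𝔰₁.cliffordMul S₁' x.1 v'.1
  let j : F₁' ≃L[ℂ] F₁ := J.toFun x.1
  let c₂ : F₂ →ₗ[ℂ] F₂ := 𝔰₂.cliffordMul S₂ x.2 v'.2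
  show (WithLp 2 (F₁ × F₁') ⊗[ℂ] F₂) →ₗ[ℂ] (WithLp 2 (F₁ × F₁') ⊗[ℂ] F₂) from
    TensorProduct.map (SmoothBundle.sumMap c₁ c₁') LinearMap.id + TensorProduct.map (swapMap j) c₂

end actions
end SpinCStructure
end SpinC

end SpinC
end

noncomputable section
namespace SpinC

/-! Everything reduces to algebra on one model fibre. The transition functions of a spinor bundle
lie in `Spin^c(n)`, so they act as `z ⊗ a` with `a` even. A complex linear isomorphism of model
fibres that is equivariant for even elements therefore commutes with all transition maps and defines
a smooth bundle isomorphism (`BundleIso.ofIntertwining`). If it also intertwines the action of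
vectors, it carries Clifford multiplication along.

On the fibre, let `e_j` and `f_k` be the generators acting on the two factors, and let `τ` be an
involution of the first factor that anticommutes with every `e_j`. Then `e_j ⊗ 1` and `τ ⊗ f_k`
satisfy the Clifford relations in dimension `k₁ + k₂` (`IsCliffordFamily.leftFamily`). For `k₁ = 2p`
take `τ = (√-1)^p ω` with `ω` the volume element; the case `k₂ = 2p` is the mirror image. If both
dimensions are odd, `ω` is central and no such `τ` lives on one irreducible module; on `Δ' ⊕ Δ''`
the swap along an isomorphism `j : Δ'' → Δ'` that anticommutes with vectors does the job. In each
case the dimension is that of a spinor module, so uniqueness of spinor modules yields the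
isomorphism (`SpinorModule.exists_equiv_of_family`).

Uniqueness is `IsIrredFamily.exists_equiv`. The maps `C_j : T ↦ f_j T e_j⁻¹` on `Hom(V, W)` are
commuting involutions, and the product of the `1 + C_j` takes values in intertwiners. For even `n`
its trace is `dim V · dim W`, since all other terms of the expansion are traceless; hence nonzero
intertwiners exist, and Schur's lemma gives `dim W = 2^(n/2)` for irreducible `W`. For odd `n` the
volume element is a scalar `± (√-1)^((n+1)/2)` on an irreducible module, so the last generator is
determined by the others and the even case applies once the two scalars agree.

This scalar explains the sign conditions. They are not needed for a mere bundle isomorphism: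
negating the action of vectors reverses the sign of an odd-dimensional module but leaves the action
of even elements, and thus the bundle, unchanged. -/

/-- A family of pairwise anticommuting square roots of `-1`. -/
structure IsCliffordFamily {R : Type*} [Ring R] {n : ℕ} (e : Fin n → R) : Prop where
  sq : ∀ j, e j * e j = -1
  anti : ∀ j k, j ≠ k → e j * e k = -(e k * e j)

/-! ### Anticommuting square roots of -1 and their volume element. -/

section ring
variable {R : Type*} [Ring R]

/-- The ordered product of a family. -/
def famVol {n : ℕ} (e : Fin n → R) : R := (List.ofFn e).prod

theorem famVol_succ {n : ℕ} (e : Fin (n + 1) → R) :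
    famVol e = e 0 * famVol (fun j => e j.succ) := by
  simp [famVol, List.ofFn_succ]

theorem famVol_succ_last {n : ℕ} (e : Fin (n + 1) → R) :
    famVol e = famVol (fun j => e j.castSucc) * e (Fin.last n) := by
  rw [famVol, List.ofFn_succ', List.concat_eq_append, List.prod_append, List.prod_singleton]
  rfl

theorem famVol_append {m n : ℕ} (e : Fin m → R) (f : Fin n → R) :
    famVol (Fin.append e f) = famVol e * famVol f := by
  simp [famVol, List.ofFn_fin_append]

theorem mul_famVol_of_anti {n : ℕ} {e : Fin n → R} {x : R} (h : ∀ j, x * e j = -(e j * x)) :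
    x * famVol e = (-1) ^ n * (famVol e * x) := by
  induction n with
  | zero => simp [famVol]
  | succ n ih =>
    rw [famVol_succ, ← mul_assoc, h, neg_mul, mul_assoc, ih fun j => h j.succ, pow_succ]
    rcases neg_one_pow_eq_or R n with h' | h' <;> simp [h', mul_assoc]

namespace IsCliffordFamily
variable {n : ℕ}

theorem comp {m : ℕ} {e : Fin n → R} (h : IsCliffordFamily e) {r : Fin m → Fin n}
    (hr : Function.Injective r) : IsCliffordFamily fun j => e (r j) :=
  ⟨fun _ => h.sq _, fun _ _ hjk => h.anti _ _ (hr.ne hjk)⟩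

/-- `e k` anticommutes with the `n - 1` other factors and commutes with itself; the exponent `n + 1`
has the parity of `n - 1` without truncated subtraction. -/
theorem mul_famVol {e : Fin n → R} (h : IsCliffordFamily e) (k : Fin n) :
    e k * famVol e = (-1) ^ (n + 1) * (famVol e * e k) := by
  induction n with
  | zero => exact k.elim0
  | succ n ih =>
    have ht := h.comp (Fin.succ_injective n)
    have h0 : e 0 * famVol (fun j => e j.succ) = (-1) ^ n * (famVol (fun j => e j.succ) * e 0) :=
      mul_famVol_of_anti fun j => h.anti _ _ (Fin.succ_ne_zero j).symm
    rw [famVol_succ]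
    refine Fin.cases ?_ (fun k => ?_) k
    · rw [mul_assoc (e 0) _ (e 0), pow_add]
      nth_rw 1 [h0]
      rcases neg_one_pow_eq_or R n with h' | h' <;> simp [h', pow_succ]
    · rw [← mul_assoc, h.anti _ _ (Fin.succ_ne_zero k), neg_mul, mul_assoc, ih ht k]
      rcases neg_one_pow_eq_or R n with h' | h' <;> simp [h', pow_succ, mul_assoc]

/-- Moving the second copy of the first generator to the left past the `n` remaining ones costs
`(-1)^n`, and its square costs another `-1`. The exponents `1, 2, …` add up to a triangular number.
-/
theorem famVol_sq {e : Fin n → R} (h : IsCliffordFamily e) :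
    famVol e * famVol e = (-1) ^ (n * (n + 1) / 2) := by
  induction n with
  | zero => simp [famVol]
  | succ n ih =>
    have ht := h.comp (Fin.succ_injective n)
    have h0 : e 0 * famVol (fun j => e j.succ) = (-1) ^ n * (famVol (fun j => e j.succ) * e 0) :=
      mul_famVol_of_anti fun j => h.anti _ _ (Fin.succ_ne_zero j).symm
    have hn : (n + 1) * (n + 1 + 1) / 2 = n * (n + 1) / 2 + (n + 1) := by
      rw [show (n + 1) * (n + 1 + 1) = n * (n + 1) + (n + 1) * 2 by ring]
      omega
    have h0' : famVol (fun j => e j.succ) * e 0 = (-1) ^ n * (e 0 * famVol (fun j => e j.succ)) := by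
      rw [h0]
      rcases neg_one_pow_eq_or R n with h' | h' <;> simp [h']
    rw [famVol_succ, hn, pow_add, ← ih ht, mul_assoc, ← mul_assoc (famVol _) (e 0), h0']
    have := h.sq 0
    rcases neg_one_pow_eq_or R n with h' | h' <;>
      simp [h', pow_succ, ← mul_assoc, this]

theorem famVol_sq_even {p : ℕ} {e : Fin n → R} (h : IsCliffordFamily e) (hn : n = 2 * p) :
    famVol e * famVol e = (-1) ^ p := by
  rw [h.famVol_sq, hn, mul_assoc, Nat.mul_div_cancel_left _ two_pos, mul_comm p, pow_mul,
    Odd.neg_one_pow ⟨p, rfl⟩]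

theorem famVol_sq_odd {e : Fin n → R} (h : IsCliffordFamily e) (hn : Odd n) :
    famVol e * famVol e = (-1) ^ ((n + 1) / 2) := by
  obtain ⟨q, rfl⟩ := hn
  rw [h.famVol_sq, show (2 * q + 1) * (2 * q + 1 + 1) = 2 * ((2 * q + 1) * (q + 1)) by ring,
    Nat.mul_div_cancel_left _ two_pos, pow_mul, Odd.neg_one_pow ⟨q, rfl⟩]
  congr 1; omega

theorem mul_famVol_even {e : Fin n → R} (h : IsCliffordFamily e) (hn : Even n) (k : Fin n) :
    e k * famVol e = -(famVol e * e k) := by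
  rw [h.mul_famVol, hn.add_one.neg_one_pow, neg_one_mul]

theorem mul_famVol_odd {e : Fin n → R} (h : IsCliffordFamily e) (hn : Odd n) (k : Fin n) :
    e k * famVol e = famVol e * e k := by
  rw [h.mul_famVol, hn.add_one.neg_one_pow, one_mul]

end IsCliffordFamily
end ring

/-! ### Averaging over the Clifford generators: intertwiners and dimension. -/

section averaging
variable {V W : Type*} [AddCommGroup V] [Module ℂ V] [FiniteDimensional ℂ V]
  [AddCommGroup W] [Module ℂ W] [FiniteDimensional ℂ W] {n : ℕ}

/-- The operator `T ↦ -b T a` on `Hom(V, W)`; if `a² = -1`, this is `T ↦ b T a⁻¹`. -/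
def conjOp (a : Module.End ℂ V) (b : Module.End ℂ W) : Module.End ℂ (V →ₗ[ℂ] W) where
  toFun T := -(b ∘ₗ T ∘ₗ a)
  map_add' T T' := by ext; simp [add_comm]
  map_smul' c T := by ext; simp

theorem conjOp_apply (a : Module.End ℂ V) (b : Module.End ℂ W) (T : V →ₗ[ℂ] W) (v : V) :
    conjOp a b T v = -b (T (a v)) := rfl

theorem conjOp_sq {a : Module.End ℂ V} {b : Module.End ℂ W} (ha : a * a = -1) (hb : b * b = -1) :
    conjOp a b * conjOp a b = 1 := by
  have ha' : ∀ v, a (a v) = -v := fun v => congrArg (fun A : Module.End ℂ V => A v) ha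
  have hb' : ∀ v, b (b v) = -v := fun v => congrArg (fun A : Module.End ℂ W => A v) hb
  ext T v
  simp [conjOp_apply, ha', hb']

/-- Exchanging the two operators produces one sign in `V` and one in `W`, and these cancel. -/
theorem conjOp_commute {a a' : Module.End ℂ V} {b b' : Module.End ℂ W} (ha : a * a' = -(a' * a))
    (hb : b * b' = -(b' * b)) : Commute (conjOp a b) (conjOp a' b') := by
  have ha' : ∀ v, a (a' v) = -a' (a v) := fun v => congrArg (fun A : Module.End ℂ V => A v) ha
  have hb' : ∀ v, b (b' v) = -b' (b v) := fun v => congrArg (fun A : Module.End ℂ W => A v) hb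
  ext T v
  simp [conjOp_apply, ha', hb']

/-- The product of the operators `1 + (T ↦ f_j T e_j⁻¹)` over a list of indices `j`. -/
def averaging (e : Fin n → Module.End ℂ V) (f : Fin n → Module.End ℂ W) (l : List (Fin n)) :
    Module.End ℂ (V →ₗ[ℂ] W) :=
  (l.map fun j => 1 + conjOp (e j) (f j)).prod

variable {e : Fin n → Module.End ℂ V} {f : Fin n → Module.End ℂ W}

theorem averaging_cons (k : Fin n) (l : List (Fin n)) :
    averaging e f (k :: l) = (1 + conjOp (e k) (f k)) * averaging e f l := by
  simp [averaging]

theorem conjOp_commute_of_family (he : IsCliffordFamily e) (hf : IsCliffordFamily f)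
    (j k : Fin n) : Commute (conjOp (e j) (f j)) (conjOp (e k) (f k)) := by
  by_cases h : j = k
  · subst h; exact Commute.refl _
  · exact conjOp_commute (he.anti _ _ h) (hf.anti _ _ h)

/-- With `C = conjOp (e j) (f j)` one has `C (1 + C) = C + C² = 1 + C`, and `C` commutes past the
other factors. So every value of the averaging operator is fixed by `C`, which means that it
intertwines `e j` with `f j`. -/
theorem conjOp_mul_averaging (he : IsCliffordFamily e) (hf : IsCliffordFamily f)
    {j : Fin n} {l : List (Fin n)} (hj : j ∈ l) :
    conjOp (e j) (f j) * averaging e f l = averaging e f l := by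
  induction l with
  | nil => simp at hj
  | cons k l ih =>
    rw [averaging_cons]
    by_cases h : j = k
    · subst h
      rw [← mul_assoc, mul_add, conjOp_sq (he.sq _) (hf.sq _), mul_one, add_comm]
    · have hc : Commute (conjOp (e j) (f j)) (1 + conjOp (e k) (f k)) :=
        (Commute.one_right _).add_right (conjOp_commute_of_family he hf j k)
      rw [← mul_assoc, hc.eq, mul_assoc, ih (by simpa [h] using hj)]

theorem averaging_intertwines (he : IsCliffordFamily e) (hf : IsCliffordFamily f)
    {j : Fin n} {l : List (Fin n)} (hj : j ∈ l) (T : V →ₗ[ℂ] W) (v : V) :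
    averaging e f l T (e j v) = f j (averaging e f l T v) := by
  have h := congrArg (fun A : Module.End ℂ (V →ₗ[ℂ] W) => A T (e j v))
    (conjOp_mul_averaging he hf hj)
  have ha : e j (e j v) = -v := congrArg (fun A : Module.End ℂ V => A v) (he.sq j)
  simp only [Module.End.mul_apply, conjOp_apply, ha, map_neg, neg_neg] at h
  exact h.symm

theorem mul_anti_of_commute {R : Type*} [Ring R] {u a b : R} (h : u * a = -(a * u))
    (hb : Commute u b) : u * (a * b) = -(a * b * u) := by
  rw [← mul_assoc, h, neg_mul, mul_assoc, hb.eq, mul_assoc]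

/-- Conjugation by the invertible `u` turns `a` into `-a`, and the trace does not see conjugation.
-/
theorem trace_eq_zero_of_anti {X : Type*} [AddCommGroup X] [Module ℂ X] [FiniteDimensional ℂ X]
    {a u u' : Module.End ℂ X} (hu : u * u' = 1) (h : u * a = -(a * u)) :
    LinearMap.trace ℂ X a = 0 := by
  have h1 : LinearMap.trace ℂ X a = LinearMap.trace ℂ X (u' * (a * u)) := by
    rw [LinearMap.trace_mul_comm, mul_assoc, hu, mul_one]
  have h2 : LinearMap.trace ℂ X (u' * (a * u)) = -LinearMap.trace ℂ X a := by
    rw [← neg_eq_iff_eq_neg.2 h, mul_neg, map_neg, LinearMap.trace_mul_comm, mul_assoc,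
      LinearMap.trace_mul_comm, mul_assoc, mul_eq_one_comm.1 hu, mul_one]
  exact self_eq_neg.1 (h1.trans h2)

/-- Expanding the product, the term 1 contributes the dimension of `Hom(V, W)` and every other term
should be traceless. The induction removes one factor at a time: `conjOp (e k) (f k)` times the
average over indices different from `k` anticommutes with an invertible operator. -/
theorem trace_averaging (hf : IsCliffordFamily f) (hn : Even n)
    {l : List (Fin n)} (hl : l.Nodup) :
    LinearMap.trace ℂ _ (averaging e f l) = Module.finrank ℂ V * Module.finrank ℂ W := by
  induction l with
  | nil => simp [averaging, Module.finrank_linearMap]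
  | cons k l ih =>
    obtain ⟨hk, hl⟩ := List.nodup_cons.1 hl
    rw [averaging_cons, add_mul, one_mul, map_add, ih hl, add_eq_left]
    -- For even `n` the volume element anticommutes with all generators, while `f k` anticommutes
    -- with all but itself. Their product thus anticommutes with `f k` alone.
    let u : Module.End ℂ W := f k * famVol f
    have hu : ∀ j, u * f j = if j = k then -(f j * u) else f j * u := by
      intro j
      have h1 := hf.mul_famVol_even hn j
      have h2 := hf.mul_famVol_even hn k
      split_ifs with h
      · subst h
        change f j * famVol f * f j = -(f j * (f j * famVol f))
        rw [mul_assoc, ← neg_eq_iff_eq_neg.2 h1, mul_neg]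
      · change f k * famVol f * f j = f j * (f k * famVol f)
        rw [← mul_assoc, hf.anti _ _ h, neg_mul, mul_assoc, mul_assoc, h1, mul_neg, neg_neg]
    -- Composition on the left with `u` transports these relations to the operators on `Hom(V, W)`;
    -- nothing is required of the `e j`.
    let L : Module.End ℂ W → Module.End ℂ (V →ₗ[ℂ] W) := LinearMap.compRight ℂ
    obtain ⟨s, hs⟩ : ∃ s : Module.End ℂ W, famVol f * s = 1 := by
      refine ⟨(-1) ^ (n * (n + 1) / 2) * famVol f, ?_⟩
      have := hf.famVol_sq
      rcases neg_one_pow_eq_or (Module.End ℂ W) (n * (n + 1) / 2) with h' | h' <;>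
        simp [h', this]
    refine trace_eq_zero_of_anti (u := L u) (u' := L (-(s * f k))) ?_ ?_
    · have : u * (-(s * f k)) = 1 := by
        change f k * famVol f * (-(s * f k)) = 1
        rw [mul_neg, mul_assoc, ← mul_assoc (famVol f), hs, one_mul, hf.sq, neg_neg]
      ext T v
      exact congrArg (fun A : Module.End ℂ W => A (T v)) this
    · have hL : ∀ j, L u * conjOp (e j) (f j) =
          if j = k then -(conjOp (e j) (f j) * L u) else conjOp (e j) (f j) * L u := by
        intro j
        have := hu j
        split_ifs at this ⊢ with h
        all_goals
          ext T v
          have h' := congrArg (fun A : Module.End ℂ W => A (T (e j v))) this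
          simp at h'
          simp [L, conjOp_apply, h']
      have hc : Commute (L u) (averaging e f l) := by
        refine Commute.list_prod_right _ _ fun x hx => ?_
        obtain ⟨j, hj, rfl⟩ := List.mem_map.1 hx
        refine (Commute.one_right _).add_right ?_
        have := hL j
        rwa [if_neg (by rintro rfl; exact hk hj)] at this
      have := hL k
      rw [if_pos rfl] at this
      exact mul_anti_of_commute this hc

/-- No proper nonzero subspace is invariant under the family. -/
def IsIrredFamily (f : Fin n → Module.End ℂ W) : Prop :=
  ∀ U : Submodule ℂ W, (∀ j, ∀ s ∈ U, f j s ∈ U) → U = ⊥ ∨ U = ⊤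

/-- Schur's lemma: an eigenspace of `A` is invariant, hence everything. -/
theorem IsIrredFamily.exists_smul_one [Nontrivial W] (hf : IsIrredFamily f) {A : Module.End ℂ W}
    (hA : ∀ j v, A (f j v) = f j (A v)) : ∃ c : ℂ, A = c • 1 := by
  obtain ⟨c, hc⟩ := Module.End.exists_eigenvalue A
  refine ⟨c, ?_⟩
  rcases hf (A.eigenspace c) fun j s hs => by
    rw [Module.End.mem_eigenspace_iff] at hs ⊢
    rw [hA, hs, map_smul] with h | h
  · exact absurd h hc
  · ext v
    exact Module.End.mem_eigenspace_iff.1 (h ▸ Submodule.mem_top)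

/-- The averaging operator has nonzero trace, so it does not vanish on some `T`, and its value there
is an intertwiner. -/
theorem exists_ne_zero_intertwiner [Nontrivial V] [Nontrivial W] (he : IsCliffordFamily e)
    (hf : IsCliffordFamily f) (hn : Even n) :
    ∃ X : V →ₗ[ℂ] W, X ≠ 0 ∧ ∀ j v, X (e j v) = f j (X v) := by
  have ht := trace_averaging (e := e) hf hn (List.nodup_finRange n)
  have h0 : averaging e f (List.finRange n) ≠ 0 := by
    intro h
    rw [h, map_zero] at ht
    exact mul_ne_zero (Nat.cast_ne_zero.2 Module.finrank_pos.ne')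
      (Nat.cast_ne_zero.2 Module.finrank_pos.ne') ht.symm
  obtain ⟨T, hT⟩ : ∃ T, averaging e f (List.finRange n) T ≠ 0 := by
    by_contra! h
    exact h0 (LinearMap.ext h)
  exact ⟨_, hT, fun j v => averaging_intertwines he hf (List.mem_finRange j) T v⟩

/-- On `End W` with `d = dim W`, the averaging operator `N` takes scalar values by Schur's lemma and
multiplies traces by `2^n`. Hence `d N(T) = 2^n tr(T) · 1`. Since `N` itself has trace `d²`, the
trace of this identity of operators on `End W` reads `d · d² = 2^n · d`. -/
theorem finrank_sq_of_even [Nontrivial W] (hf : IsCliffordFamily f) (hi : IsIrredFamily f)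
    (hn : Even n) : Module.finrank ℂ W ^ 2 = 2 ^ n := by
  have ht := trace_averaging (e := f) hf hn (List.nodup_finRange n)
  -- Each factor `1 + C` doubles the trace, because `C` is a conjugation when both families
  -- coincide.
  have htr : ∀ (l : List (Fin n)) (T : Module.End ℂ W),
      LinearMap.trace ℂ W (averaging f f l T) = 2 ^ l.length * LinearMap.trace ℂ W T := by
    intro l T
    induction l with
    | nil => simp [averaging]
    | cons k l ih =>
      have : ∀ T, LinearMap.trace ℂ W (conjOp (f k) (f k) T) = LinearMap.trace ℂ W T := by
        intro T
        change LinearMap.trace ℂ W (-(f k * (T * f k))) = _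
        rw [map_neg, LinearMap.trace_mul_comm, mul_assoc, hf.sq, mul_neg, mul_one, map_neg, neg_neg]
      rw [averaging_cons, Module.End.mul_apply, LinearMap.add_apply, map_add, this,
        Module.End.one_apply, ih, List.length_cons]
      ring
  set d : ℂ := (Module.finrank ℂ W : ℂ) with hd
  have hd0 : d ≠ 0 := Nat.cast_ne_zero.2 Module.finrank_pos.ne'
  have hN : d • averaging f f (List.finRange n) =
      (2 ^ n : ℂ) • (LinearMap.trace ℂ W).smulRight (1 : Module.End ℂ W) := by
    refine LinearMap.ext fun T => ?_
    obtain ⟨c, hc⟩ := hi.exists_smul_one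
      fun j v => averaging_intertwines hf hf (List.mem_finRange j) T v
    have h1 := htr (List.finRange n) T
    rw [hc, map_smul, LinearMap.trace_one, List.length_finRange, smul_eq_mul, ← hd] at h1
    rw [LinearMap.smul_apply, hc, LinearMap.smul_apply, LinearMap.smulRight_apply, smul_smul,
      smul_smul, ← h1, mul_comm]
  have h2 := congrArg (LinearMap.trace ℂ _) hN
  rw [map_smul, map_smul, ht, LinearMap.trace_smulRight, LinearMap.trace_one, ← hd, smul_eq_mul,
    smul_eq_mul, mul_comm _ d] at h2
  have h3 := mul_left_cancel₀ hd0 (h2.trans (mul_comm _ _))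
  rw [hd, ← pow_two] at h3
  exact_mod_cast h3

end averaging

/-! ### Dimension and uniqueness of irreducible modules. -/

section uniqueness
variable {V W : Type*} [AddCommGroup V] [Module ℂ V] [FiniteDimensional ℂ V]
  [AddCommGroup W] [Module ℂ W] [FiniteDimensional ℂ W] {n : ℕ}

theorem famVol_intertwines {e : Fin n → Module.End ℂ V} {f : Fin n → Module.End ℂ W}
    {X : V →ₗ[ℂ] W} (hX : ∀ j v, X (e j v) = f j (X v)) (v : V) :
    X (famVol e v) = famVol f (X v) := by
  induction n with
  | zero => simp [famVol]
  | succ n ih =>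
    rw [famVol_succ, famVol_succ, Module.End.mul_apply, Module.End.mul_apply, hX,
      ih fun j v => hX j.succ v]

theorem famVol_mem {f : Fin n → Module.End ℂ W} {U : Submodule ℂ W}
    (hU : ∀ j, ∀ s ∈ U, f j s ∈ U) {s : W} (hs : s ∈ U) : famVol f s ∈ U := by
  induction n with
  | zero => simpa [famVol] using hs
  | succ n ih =>
    rw [famVol_succ, Module.End.mul_apply]
    exact hU _ _ (ih fun j s hs => hU j.succ s hs)

/-- Let `ω'` be the product of all generators but the last. Multiplying `ω' f_last = c` by `ω'`,
whose square is a sign, solves for the last generator. This is what reduces odd dimensions to even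
ones. -/
theorem IsCliffordFamily.last_eq {f : Fin (n + 1) → Module.End ℂ W} (hf : IsCliffordFamily f)
    {c : ℂ} (hc : famVol f = c • 1) :
    f (Fin.last n) = ((-1) ^ (n * (n + 1) / 2) * c) • famVol fun j => f j.castSucc := by
  have h := (hf.comp (Fin.castSucc_injective n)).famVol_sq
  rw [famVol_succ_last] at hc
  have h2 := congrArg (fun A => (famVol fun j => f j.castSucc) * A) hc
  simp only [← mul_assoc, h, mul_smul_comm, mul_one] at h2
  rw [mul_smul, ← h2]
  rcases Nat.even_or_odd (n * (n + 1) / 2) with h' | h' <;> simp [h'.neg_one_pow]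

/-- The last generator is a multiple of the product of the others, so it preserves every subspace
that they preserve. -/
theorem IsIrredFamily.castSucc {f : Fin (n + 1) → Module.End ℂ W} (hi : IsIrredFamily f)
    (hf : IsCliffordFamily f) {c : ℂ} (hc : famVol f = c • 1) :
    IsIrredFamily fun j : Fin n => f j.castSucc := by
  refine fun U hU => hi U fun j => Fin.lastCases (fun s hs => ?_) (fun j => hU j) j
  rw [hf.last_eq hc]
  exact U.smul_mem _ (famVol_mem hU hs)

variable {e : Fin n → Module.End ℂ V} {f : Fin n → Module.End ℂ W}

/-- For odd `n` the volume element commutes with all generators, so it is a scalar by Schur's lemma.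
Its square is `(-1)^((n+1)/2)`, which leaves two square roots. -/
theorem IsIrredFamily.exists_famVol [Nontrivial W] (hi : IsIrredFamily f)
    (hf : IsCliffordFamily f) (hn : Odd n) :
    ∃ ε : ℤˣ, famVol f = (((ε : ℤ) : ℂ) * Complex.I ^ ((n + 1) / 2)) • 1 := by
  obtain ⟨c, hc⟩ := hi.exists_smul_one (A := famVol f) fun j v =>
    congrArg (fun A : Module.End ℂ W => A v) (hf.mul_famVol_odd hn j).symm
  obtain ⟨w, hw⟩ := exists_ne (0 : W)
  have h1 := congrArg (fun A : Module.End ℂ W => A w) (hf.famVol_sq_odd hn)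
  have h2 : c * c = (-1) ^ ((n + 1) / 2) := by
    refine smul_left_injective ℂ hw ?_
    rcases Nat.even_or_odd ((n + 1) / 2) with h' | h' <;>
      simpa [hc, h'.neg_one_pow, smul_smul] using h1
  have h3 : c ^ 2 = (Complex.I ^ ((n + 1) / 2)) ^ 2 := by
    rw [← pow_mul, mul_comm _ 2, pow_mul, Complex.I_sq, ← h2, pow_two]
  rcases sq_eq_sq_iff_eq_or_eq_neg.1 h3 with h | h
  · exact ⟨1, by simp [hc, h]⟩
  · exact ⟨-1, by simp [hc, h]⟩

theorem IsIrredFamily.finrank_eq [Nontrivial W] (hi : IsIrredFamily f)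
    (hf : IsCliffordFamily f) : Module.finrank ℂ W = 2 ^ (n / 2) := by
  have key : ∀ {q : ℕ}, Module.finrank ℂ W ^ 2 = 2 ^ (q + q) → Module.finrank ℂ W = 2 ^ q :=
    fun {q} h => Nat.pow_left_injective two_ne_zero (by simp only [h]; ring)
  rcases Nat.even_or_odd' n with ⟨q, rfl | rfl⟩
  · rw [Nat.mul_div_cancel_left _ two_pos]
    exact key (by rw [finrank_sq_of_even hf hi (even_two_mul q), two_mul])
  · obtain ⟨ε, hc⟩ := hi.exists_famVol hf ⟨q, rfl⟩
    rw [show (2 * q + 1) / 2 = q by omega]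
    exact key (by rw [finrank_sq_of_even (hf.comp (Fin.castSucc_injective _)) (hi.castSucc hf hc)
      (even_two_mul q), two_mul])

/-- The range of a nonzero intertwiner is invariant, so it is all of the irreducible `W`; equality
of dimensions then gives injectivity. Irreducibility of `V` is not needed, so it never has to be
checked for the tensor products below. -/
theorem IsIrredFamily.exists_equiv [Nontrivial W] (hi : IsIrredFamily f)
    (he : IsCliffordFamily e) (hf : IsCliffordFamily f)
    (hd : Module.finrank ℂ V = Module.finrank ℂ W)
    (hv : Odd n → ∃ c : ℂ, famVol e = c • 1 ∧ famVol f = c • 1) :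
    ∃ X : V ≃ₗ[ℂ] W, ∀ j v, X (e j v) = f j (X v) := by
  have : Nontrivial V := Module.nontrivial_of_finrank_pos (R := ℂ) (hd ▸ Module.finrank_pos)
  obtain ⟨X, h0, hX⟩ : ∃ X : V →ₗ[ℂ] W, X ≠ 0 ∧ ∀ j v, X (e j v) = f j (X v) := by
    rcases Nat.even_or_odd n with hn | hn
    · exact exists_ne_zero_intertwiner he hf hn
    · obtain ⟨c, hce, hcf⟩ := hv hn
      obtain ⟨q, rfl⟩ := hn
      obtain ⟨X, h0, hX⟩ := exists_ne_zero_intertwiner (he.comp (Fin.castSucc_injective _))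
        (hf.comp (Fin.castSucc_injective _)) (even_two_mul q)
      -- An intertwiner of the first `2q` generators respects the last one too: on both sides it is
      -- the same multiple of their product, as the scalar `c` is shared.
      refine ⟨X, h0, fun j => Fin.lastCases (fun v => ?_) (fun j => hX j) j⟩
      rw [he.last_eq hce, hf.last_eq hcf, LinearMap.smul_apply, map_smul, famVol_intertwines hX]
      rfl
  have hr : LinearMap.range X = ⊤ := by
    refine (hi (LinearMap.range X) ?_).resolve_left fun h => h0 (LinearMap.range_eq_bot.1 h)
    rintro j _ ⟨v, rfl⟩
    exact ⟨e j v, hX j v⟩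
  have hs := LinearMap.range_eq_top.1 hr
  exact ⟨.ofBijective X ⟨(LinearMap.injective_iff_surjective_of_finrank_eq_finrank hd).2 hs, hs⟩, hX⟩

end uniqueness

/-! ### Clifford families on tensor products. -/

section families

theorem IsCliffordFamily.append {R : Type*} [Ring R] {m n : ℕ} {e : Fin m → R} {f : Fin n → R}
    (he : IsCliffordFamily e) (hf : IsCliffordFamily f) (h : ∀ j k, e j * f k = -(f k * e j)) :
    IsCliffordFamily (Fin.append e f) where
  sq j := by
    refine Fin.addCases (fun j => ?_) (fun j => ?_) j
    · simpa using he.sq j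
    · simpa using hf.sq j
  anti j k := by
    refine Fin.addCases (fun j => ?_) (fun j => ?_) j <;>
      refine Fin.addCases (fun k => ?_) (fun k => ?_) k <;> intro hjk
    · simpa using he.anti j k fun H => hjk (by rw [H])
    · simpa using h j k
    · simpa using neg_eq_iff_eq_neg.1 (h k j).symm
    · simpa using hf.anti j k fun H => hjk (by rw [H])

theorem famVol_neg {R : Type*} [Ring R] {n : ℕ} (e : Fin n → R) :
    famVol (fun j => -e j) = (-1) ^ n * famVol e := by
  induction n with
  | zero => simp [famVol]
  | succ n ih =>
    rw [famVol_succ, famVol_succ, ih, pow_succ]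
    rcases neg_one_pow_eq_or R n with h' | h' <;> simp [h']

variable {V W : Type*} [AddCommGroup V] [Module ℂ V] [AddCommGroup W] [Module ℂ W] {m n : ℕ}

theorem tensorMap_mul (a a' : Module.End ℂ V) (b b' : Module.End ℂ W) :
    TensorProduct.map a b * TensorProduct.map a' b' = TensorProduct.map (a * a') (b * b') :=
  (TensorProduct.map_mul a a' b b').symm

theorem tensorMap_neg_left (a : Module.End ℂ V) (b : Module.End ℂ W) :
    TensorProduct.map (-a) b = -TensorProduct.map a b := by
  ext x y
  exact TensorProduct.neg_tmul _ _

theorem tensorMap_neg_right (a : Module.End ℂ V) (b : Module.End ℂ W) :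
    TensorProduct.map a (-b) = -TensorProduct.map a b := by
  ext x y
  exact TensorProduct.tmul_neg _ _

theorem tensorMap_one : (TensorProduct.map 1 1 : Module.End ℂ (V ⊗[ℂ] W)) = 1 :=
  TensorProduct.map_one

theorem IsCliffordFamily.tensor_right {e : Fin m → Module.End ℂ V} (he : IsCliffordFamily e)
    {τ : Module.End ℂ W} (hτ : τ * τ = 1) :
    IsCliffordFamily fun j => (TensorProduct.map (e j) τ : Module.End ℂ (V ⊗[ℂ] W)) where
  sq j := by rw [tensorMap_mul, he.sq, hτ, tensorMap_neg_left, tensorMap_one]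
  anti j k h := by
    rw [tensorMap_mul, tensorMap_mul, he.anti j k h, hτ, tensorMap_neg_left]

theorem IsCliffordFamily.tensor_left {e : Fin m → Module.End ℂ W} (he : IsCliffordFamily e)
    {τ : Module.End ℂ V} (hτ : τ * τ = 1) :
    IsCliffordFamily fun j => (TensorProduct.map τ (e j) : Module.End ℂ (V ⊗[ℂ] W)) where
  sq j := by rw [tensorMap_mul, he.sq, hτ, tensorMap_neg_right, tensorMap_one]
  anti j k h := by
    rw [tensorMap_mul, tensorMap_mul, he.anti j k h, hτ, tensorMap_neg_right]

theorem famVol_tensor_right (e : Fin m → Module.End ℂ V) (τ : Module.End ℂ W) :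
    famVol (fun j => (TensorProduct.map (e j) τ : Module.End ℂ (V ⊗[ℂ] W))) =
      TensorProduct.map (famVol e) (τ ^ m) := by
  induction m with
  | zero => simp only [famVol, List.ofFn_zero, List.prod_nil, pow_zero, tensorMap_one]
  | succ m ih => rw [famVol_succ, ih, tensorMap_mul, ← pow_succ', famVol_succ]

theorem famVol_tensor_left (e : Fin m → Module.End ℂ W) (τ : Module.End ℂ V) :
    famVol (fun j => (TensorProduct.map τ (e j) : Module.End ℂ (V ⊗[ℂ] W))) =
      TensorProduct.map (τ ^ m) (famVol e) := by
  induction m with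
  | zero => simp only [famVol, List.ofFn_zero, List.prod_nil, pow_zero, tensorMap_one]
  | succ m ih => rw [famVol_succ, ih, tensorMap_mul, ← pow_succ', famVol_succ]

/-- The generators `e_j ⊗ 1` and `τ ⊗ f_k` on `V ⊗ W`. -/
def leftFamily (e : Fin m → Module.End ℂ V) (τ : Module.End ℂ V) (f : Fin n → Module.End ℂ W) :
    Fin (m + n) → Module.End ℂ (V ⊗[ℂ] W) :=
  Fin.append (fun j => TensorProduct.map (e j) 1) fun k => TensorProduct.map τ (f k)

/-- The generators `e_j ⊗ τ` and `1 ⊗ f_k` on `V ⊗ W`. -/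
def rightFamily (e : Fin m → Module.End ℂ V) (τ : Module.End ℂ W) (f : Fin n → Module.End ℂ W) :
    Fin (m + n) → Module.End ℂ (V ⊗[ℂ] W) :=
  Fin.append (fun j => TensorProduct.map (e j) τ) fun k => TensorProduct.map 1 (f k)

variable {e : Fin m → Module.End ℂ V} {f : Fin n → Module.End ℂ W}

/-- Without `τ` the two groups of generators would commute. Since `τ` anticommutes with each `e j`
it supplies the missing sign, and `τ² = 1` keeps the squares equal to `-1`. -/
theorem IsCliffordFamily.leftFamily (he : IsCliffordFamily e) (hf : IsCliffordFamily f)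
    {τ : Module.End ℂ V} (hτ : τ * τ = 1) (h : ∀ j, e j * τ = -(τ * e j)) :
    IsCliffordFamily (leftFamily e τ f) :=
  (he.tensor_right (mul_one 1)).append (hf.tensor_left hτ) fun j k => by
    rw [tensorMap_mul, tensorMap_mul, h, one_mul, mul_one, tensorMap_neg_left]

theorem IsCliffordFamily.rightFamily (he : IsCliffordFamily e) (hf : IsCliffordFamily f)
    {τ : Module.End ℂ W} (hτ : τ * τ = 1) (h : ∀ j, f j * τ = -(τ * f j)) :
    IsCliffordFamily (rightFamily e τ f) :=
  (he.tensor_right hτ).append (hf.tensor_left (mul_one 1)) fun j k => by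
    rw [tensorMap_mul, tensorMap_mul, h, one_mul, mul_one, tensorMap_neg_right, neg_neg]

/-- `√-1 ^ p` times the volume element is an involution. -/
theorem IsCliffordFamily.smul_famVol_sq {p : ℕ} (he : IsCliffordFamily e) (hm : m = 2 * p) :
    (Complex.I ^ p • famVol e) * (Complex.I ^ p • famVol e) = 1 := by
  rw [smul_mul_smul_comm, he.famVol_sq_even hm, ← mul_pow, Complex.I_mul_I]
  rcases Nat.even_or_odd p with h' | h' <;> simp [h'.neg_one_pow]

theorem IsCliffordFamily.mul_smul_famVol (he : IsCliffordFamily e) (hm : Even m) (c : ℂ)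
    (j : Fin m) : e j * (c • famVol e) = -((c • famVol e) * e j) := by
  rw [mul_smul_comm, smul_mul_assoc, he.mul_famVol_even hm, smul_neg]

/-- As `n` is odd, the `n` copies of `τ = (√-1)^p ω` multiply to `τ`, so the first tensor factor is
`ω τ = (√-1)^p ω² = (-1)^p (√-1)^p`. This is the origin of the factor `(-1)^p` in the sign
condition. -/
theorem famVol_leftFamily {p : ℕ} (he : IsCliffordFamily e) (hm : m = 2 * p) (hn : Odd n) :
    famVol (leftFamily e (Complex.I ^ p • famVol e) f) =
      (((-1) ^ p * Complex.I ^ p : ℂ)) • TensorProduct.map 1 (famVol f) := by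
  obtain ⟨q, rfl⟩ := hn
  rw [leftFamily, famVol_append, famVol_tensor_right, famVol_tensor_left, tensorMap_mul, one_pow,
    one_mul, pow_succ, pow_mul, pow_two, he.smul_famVol_sq hm, one_pow, one_mul, mul_smul_comm,
    he.famVol_sq_even hm, ← TensorProduct.map_smul_left]
  rcases Nat.even_or_odd p with h' | h' <;> simp [h'.neg_one_pow]

theorem famVol_rightFamily {p : ℕ} (hf : IsCliffordFamily f) (hn : n = 2 * p) (hm : Odd m) :
    famVol (rightFamily e (Complex.I ^ p • famVol f) f) =
      (((-1) ^ p * Complex.I ^ p : ℂ)) • TensorProduct.map (famVol e) 1 := by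
  obtain ⟨q, rfl⟩ := hm
  rw [rightFamily, famVol_append, famVol_tensor_right, famVol_tensor_left, tensorMap_mul, one_pow,
    mul_one, pow_succ, pow_mul, pow_two, hf.smul_famVol_sq hn, one_pow, one_mul, smul_mul_assoc,
    hf.famVol_sq_even hn, ← TensorProduct.map_smul_right]
  rcases Nat.even_or_odd p with h' | h' <;> simp [h'.neg_one_pow]

end families

/-! ### Spinor modules as irreducible Clifford families, and their twists. -/

namespace SpinorModule
variable {n : ℕ} {F : Type*} [NormedAddCommGroup F] [InnerProductSpace ℂ F]

/-- Clifford multiplication by the standard basis vectors. -/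
def gen (S : SpinorModule n F) (j : Fin n) : Module.End ℂ F :=
  S.clifford (CliffordAlgebra.ι (Q n) (Pi.single j 1))

theorem Q_single (j : Fin n) : Q n (Pi.single j 1) = -1 := by
  simp [Pi.single_apply]

theorem ι_anti (j k : Fin n) (h : j ≠ k) :
    CliffordAlgebra.ι (Q n) (Pi.single j 1) * CliffordAlgebra.ι (Q n) (Pi.single k 1) =
      -(CliffordAlgebra.ι (Q n) (Pi.single k 1) * CliffordAlgebra.ι (Q n) (Pi.single j 1)) := by
  refine CliffordAlgebra.ι_mul_ι_comm_of_isOrtho ?_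
  rw [QuadraticMap.isOrtho_def]
  simp only [QuadraticMap.weightedSumSquares_apply, ← Finset.sum_add_distrib]
  refine Finset.sum_congr rfl fun i _ => ?_
  by_cases hj : i = j
  · subst hj; simp [h]
  · simp [hj]

/-- Stated for any algebra homomorphism because it is also needed for the direct sum `sumHom`, which
is not a spinor module. -/
theorem isCliffordFamily_gen_of_algHom {A : Type*} [Ring A] [Algebra ℝ A] (c : Cl n →ₐ[ℝ] A) :
    IsCliffordFamily fun j => c (CliffordAlgebra.ι (Q n) (Pi.single j 1)) where
  sq j := by rw [← map_mul, CliffordAlgebra.ι_sq_scalar, Q_single]; simp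
  anti j k h := by rw [← map_mul, ι_anti j k h, map_neg, map_mul]

variable (S : SpinorModule n F)

theorem isCliffordFamily_gen : IsCliffordFamily S.gen := isCliffordFamily_gen_of_algHom S.clifford

theorem famVol_gen : famVol S.gen = S.vol := by
  rw [famVol, vol, map_list_prod, List.map_ofFn]
  rfl

theorem algHom_ι_eq_sum {A : Type*} [Ring A] [Algebra ℝ A] (c : Cl n →ₐ[ℝ] A) (v : Fin n → ℝ) :
    c (CliffordAlgebra.ι (Q n) v) =
      ∑ j, v j • c (CliffordAlgebra.ι (Q n) (Pi.single j 1)) := by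
  conv_lhs => rw [pi_eq_sum_univ' v]
  simp

theorem isIrredFamily_gen : IsIrredFamily S.gen := by
  refine fun U hU => S.irreducible U fun v s hs => ?_
  rw [algHom_ι_eq_sum, LinearMap.sum_apply]
  exact U.sum_mem fun j _ => U.smul_mem (v j : ℂ) (hU j s hs)

/-- The spinor module with the opposite Clifford multiplication by vectors. -/
def twist : SpinorModule n F where
  clifford := S.clifford.comp CliffordAlgebra.involute
  nontrivial := S.nontrivial
  irreducible U hU := S.irreducible U fun v s hs => by
    simpa using hU v s hs

theorem twist_gen (j : Fin n) : S.twist.gen j = -S.gen j := by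
  simp [gen, twist]

/-- Transition functions are even up to complex scalars, so a module and its twist have the same
transition maps, although for odd `n` they have opposite signs. -/
theorem twist_clifford_of_even {a : Cl n} (ha : a ∈ CliffordAlgebra.evenOdd (Q n) 0) :
    S.twist.clifford a = S.clifford a := by
  change S.clifford (CliffordAlgebra.involute a) = _
  rw [CliffordAlgebra.involute_eq_of_mem_even ha]

theorem hasSign_twist (hn : Odd n) {ε : ℤˣ} (h : S.HasSign ε) : S.twist.HasSign (-ε) := by
  have h1 : S.twist.vol = -S.vol := by
    rw [← famVol_gen, ← famVol_gen, show S.twist.gen = fun j => -S.gen j from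
      funext S.twist_gen, famVol_neg, hn.neg_one_pow, neg_one_mul]
  have h2 : S.vol = _ := h
  rw [HasSign, h1, h2]
  simp

theorem exists_hasSign [FiniteDimensional ℂ F] (hn : Odd n) : ∃ ε : ℤˣ, S.HasSign ε := by
  have := S.nontrivial
  obtain ⟨ε, h⟩ := S.isIrredFamily_gen.exists_famVol S.isCliffordFamily_gen hn
  exact ⟨ε, S.famVol_gen.symm.trans h⟩

theorem finrank_eq (S : SpinorModule n F) [FiniteDimensional ℂ F] : Module.finrank ℂ F = 2 ^ (n / 2) :=
  have := S.nontrivial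
  S.isIrredFamily_gen.finrank_eq S.isCliffordFamily_gen

end SpinorModule

/-! ### From generators to vectors and to even elements. -/

section equivariance
variable {V W F : Type*} [NormedAddCommGroup V] [InnerProductSpace ℂ V] [NormedAddCommGroup W]
  [InnerProductSpace ℂ W] [NormedAddCommGroup F] [InnerProductSpace ℂ F] {m n : ℕ}

theorem algHom_ι_eq_complex_sum (c : Cl n →ₐ[ℝ] Module.End ℂ F) (v : Fin n → ℝ) :
    c (CliffordAlgebra.ι (Q n) v) =
      ∑ j, (v j : ℂ) • c (CliffordAlgebra.ι (Q n) (Pi.single j 1)) :=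
  SpinorModule.algHom_ι_eq_sum c v

variable {S : SpinorModule (m + n) F} {c₁ : Cl m →ₐ[ℝ] Module.End ℂ V}
  {c₂ : Cl n →ₐ[ℝ] Module.End ℂ W} {τ₁ : Module.End ℂ V} {τ₂ : Module.End ℂ W}
  {φ : F →ₗ[ℂ] V ⊗[ℂ] W}

/-- Both sides are linear in `v` and `w`. The two operators `τ₁`, `τ₂` let one statement serve the
left even and odd cases (`τ₂ = 1`) and the right even case (`τ₁ = 1`). -/
theorem map_clifford_append
    (h₁ : ∀ j s, φ (S.gen (Fin.castAdd n j) s) =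
      TensorProduct.map (c₁ (CliffordAlgebra.ι (Q m) (Pi.single j 1))) τ₂ (φ s))
    (h₂ : ∀ k s, φ (S.gen (Fin.natAdd m k) s) =
      TensorProduct.map τ₁ (c₂ (CliffordAlgebra.ι (Q n) (Pi.single k 1))) (φ s))
    (v : Fin m → ℝ) (w : Fin n → ℝ) (s : F) :
    φ (S.clifford (CliffordAlgebra.ι (Q (m + n)) (Fin.append v w)) s) =
      TensorProduct.map (c₁ (CliffordAlgebra.ι (Q m) v)) τ₂ (φ s) +
        TensorProduct.map τ₁ (c₂ (CliffordAlgebra.ι (Q n) w)) (φ s) := by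
  have e₁ : TensorProduct.map (c₁ (CliffordAlgebra.ι (Q m) v)) τ₂ =
      ∑ j, (v j : ℂ) •
        TensorProduct.map (c₁ (CliffordAlgebra.ι (Q m) (Pi.single j 1))) τ₂ := by
    rw [algHom_ι_eq_complex_sum c₁]
    simp only [← TensorProduct.mapBilinear_apply, map_sum, map_smul, LinearMap.sum_apply,
      LinearMap.smul_apply]
  have e₂ : TensorProduct.map τ₁ (c₂ (CliffordAlgebra.ι (Q n) w)) =
      ∑ k, (w k : ℂ) •
        TensorProduct.map τ₁ (c₂ (CliffordAlgebra.ι (Q n) (Pi.single k 1))) := by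
    rw [algHom_ι_eq_complex_sum c₂]
    simp only [← TensorProduct.mapBilinear_apply, map_sum, map_smul]
  rw [algHom_ι_eq_complex_sum, Fin.sum_univ_add, e₁, e₂]
  simp only [LinearMap.add_apply, LinearMap.sum_apply, LinearMap.smul_apply, map_add, map_sum,
    map_smul, Fin.append_left, Fin.append_right, ← h₁, ← h₂]
  rfl

/-- An even element is built from products of pairs of vectors. Each pair brings `τ₁²` or `τ₂²`,
which is 1, so the twisting disappears and only the plain tensor product action remains. This action
is the one that defines the transition maps of the tensor product bundle. -/
theorem map_clifford_even (hτ₁ : τ₁ * τ₁ = 1) (hτ₂ : τ₂ * τ₂ = 1)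
    (h : ∀ v w s, φ (S.clifford (CliffordAlgebra.ι (Q (m + n)) (Fin.append v w)) s) =
      TensorProduct.map (c₁ (CliffordAlgebra.ι (Q m) v)) τ₂ (φ s) +
        TensorProduct.map τ₁ (c₂ (CliffordAlgebra.ι (Q n) w)) (φ s))
    {a₁ : Cl m} (ha₁ : a₁ ∈ CliffordAlgebra.evenOdd (Q m) 0)
    {a₂ : Cl n} (ha₂ : a₂ ∈ CliffordAlgebra.evenOdd (Q n) 0) (s : F) :
    φ (S.clifford (CliffordAlgebra.map (inl m n) a₁ * CliffordAlgebra.map (inr m n) a₂) s) =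
      TensorProduct.map (c₁ a₁) (c₂ a₂) (φ s) := by
  have h₁ : ∀ v s, φ (S.clifford (CliffordAlgebra.map (inl m n) (CliffordAlgebra.ι (Q m) v)) s) =
      TensorProduct.map (c₁ (CliffordAlgebra.ι (Q m) v)) τ₂ (φ s) := fun v s => by
    have := h v 0 s
    rw [map_zero, map_zero, TensorProduct.map_zero_right, LinearMap.zero_apply, add_zero] at this
    rw [CliffordAlgebra.map_apply_ι]
    exact this
  have h₂ : ∀ w s, φ (S.clifford (CliffordAlgebra.map (inr m n) (CliffordAlgebra.ι (Q n) w)) s) =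
      TensorProduct.map τ₁ (c₂ (CliffordAlgebra.ι (Q n) w)) (φ s) := fun w s => by
    have := h 0 w s
    rw [map_zero, map_zero, TensorProduct.map_zero_left, LinearMap.zero_apply, zero_add] at this
    rw [CliffordAlgebra.map_apply_ι]
    exact this
  have H₁ : ∀ s, φ (S.clifford (CliffordAlgebra.map (inl m n) a₁) s) =
      TensorProduct.map (c₁ a₁) 1 (φ s) := by
    induction a₁, ha₁ using CliffordAlgebra.even_induction with
    | algebraMap r =>
      intro s
      simp only [AlgHom.commutes, Module.algebraMap_end_apply]
      have : TensorProduct.map (algebraMap ℝ (Module.End ℂ V) r) (1 : Module.End ℂ W) =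
          (r : ℂ) • 1 := by
        rw [← tensorMap_one, ← TensorProduct.map_smul_left]; rfl
      rw [this]
      exact map_smul φ (r : ℂ) s
    | add x y _ _ hx hy =>
      intro s
      simp only [map_add, LinearMap.add_apply, hx, hy, TensorProduct.map_add_left]
    | ι_mul_ι_mul v w x _ hx =>
      intro s
      simp only [map_mul, Module.End.mul_apply, h₁, hx]
      simp only [← Module.End.mul_apply, tensorMap_mul, hτ₂, mul_one]
      rw [mul_assoc]
  have H₂ : ∀ s, φ (S.clifford (CliffordAlgebra.map (inr m n) a₂) s) =
      TensorProduct.map 1 (c₂ a₂) (φ s) := by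
    induction a₂, ha₂ using CliffordAlgebra.even_induction with
    | algebraMap r =>
      intro s
      simp only [AlgHom.commutes, Module.algebraMap_end_apply]
      have : TensorProduct.map (1 : Module.End ℂ V) (algebraMap ℝ (Module.End ℂ W) r) =
          (r : ℂ) • 1 := by
        rw [← tensorMap_one, ← TensorProduct.map_smul_right]; rfl
      rw [this]
      exact map_smul φ (r : ℂ) s
    | add x y _ _ hx hy =>
      intro s
      simp only [map_add, LinearMap.add_apply, hx, hy, TensorProduct.map_add_right]
    | ι_mul_ι_mul v w x _ hx =>
      intro s
      simp only [map_mul, Module.End.mul_apply, h₂, hx]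
      simp only [← Module.End.mul_apply, tensorMap_mul, hτ₁, mul_one]
      rw [mul_assoc]
  rw [map_mul, Module.End.mul_apply, H₁, H₂, ← Module.End.mul_apply, tensorMap_mul, mul_one,
    one_mul]

/-- The signs from the two vectors of each pair cancel. -/
theorem algHom_even_intertwines {n : ℕ} {c : Cl n →ₐ[ℝ] Module.End ℂ V}
    {d : Cl n →ₐ[ℝ] Module.End ℂ W} {φ : V →ₗ[ℂ] W}
    (h : ∀ v s, φ (c (CliffordAlgebra.ι (Q n) v) s) = -d (CliffordAlgebra.ι (Q n) v) (φ s))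
    {a : Cl n} (ha : a ∈ CliffordAlgebra.evenOdd (Q n) 0) (s : V) : φ (c a s) = d a (φ s) := by
  induction a, ha using CliffordAlgebra.even_induction generalizing s with
  | algebraMap r =>
    simp only [AlgHom.commutes, Module.algebraMap_end_apply]
    exact map_smul φ (r : ℂ) s
  | add x y _ _ hx hy => simp only [map_add, LinearMap.add_apply, hx, hy]
  | ι_mul_ι_mul v w x _ hx => simp only [map_mul, Module.End.mul_apply, h, hx, map_neg, neg_neg]

end equivariance

/-! ### Bundle isomorphisms from constant maps of the fibres. -/

section bundles
variable {E H M : Type*} [NormedAddCommGroup E] [NormedSpace ℝ E] [TopologicalSpace H]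
  [TopologicalSpace M] [ChartedSpace H M] {I : ModelWithCorners ℝ E H}
  {F F' : Type*} [NormedAddCommGroup F] [InnerProductSpace ℂ F] [FiniteDimensional ℂ F]
  [NormedAddCommGroup F'] [InnerProductSpace ℂ F'] [FiniteDimensional ℂ F'] {ι ι' : Type*}

/-- The isomorphism of bundles given by a linear isomorphism of the model fibres which intertwines
the transition maps. -/
def BundleIso.ofIntertwining {B : SmoothBundle I M F ι} {B' : SmoothBundle I M F' ι'}
    (r : ι → ι') (hr : ∀ i, B'.baseSet (r i) = B.baseSet i)
    (hidx : ∀ x, B'.indexAt x = r (B.indexAt x)) (φ : F ≃ₗ[ℂ] F')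
    (h : ∀ i j, ∀ x ∈ B.baseSet i ∩ B.baseSet j, ∀ s,
      φ (B.coordChange i j x s) = B'.coordChange (r i) (r j) x (φ s)) : BundleIso B B' where
  toFun _ := show F ≃L[ℂ] F' from φ.toContinuousLinearEquiv
  smooth i j := by
    -- In the trivialisations `i` and `j` the map turns out to be `φ` followed by the change from `r
    -- i` to `j`: moving `φ` past the change from `i` to the preferred index at `x` lets the cocycle
    -- condition remove that index, which may jump with `x`.
    have h1 : ContMDiffOn I 𝓘(ℝ, F →L[ℂ] F') ∞ (fun x => (B'.coordChange (r i) j x).comp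
        (φ.toContinuousLinearEquiv : F →L[ℂ] F')) (B'.baseSet (r i) ∩ B'.baseSet j) := by
      let _ : FiniteDimensional ℝ (F' →L[ℂ] F') := FiniteDimensional.complexToReal _
      exact SmoothBundle.contMDiffOn_linear
        { toFun := fun A : F' →L[ℂ] F' => A.comp (φ.toContinuousLinearEquiv : F →L[ℂ] F')
          map_add' := fun _ _ => by ext; rfl
          map_smul' := fun _ _ => by ext; rfl } (B'.smooth_coordChange (r i) j)
    rw [hr] at h1
    refine h1.congr fun x hx => ContinuousLinearMap.ext fun s => ?_
    have hx' := B.mem_baseSet_at x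
    change B'.coordChange (B'.indexAt x) j x (φ (B.coordChange i (B.indexAt x) x s)) =
      B'.coordChange (r i) j x (φ s)
    rw [h _ _ x ⟨hx.1, hx'⟩, hidx]
    exact B'.coordChange_comp _ _ _ _ ⟨⟨(hr i).symm ▸ hx.1, (hr _).symm ▸ hx'⟩, hx.2⟩ _

end bundles

/-! ### Isomorphisms of spinor modules for a product. -/

section modules
variable {F F₁ F₁' F₂ : Type*}
  [NormedAddCommGroup F] [InnerProductSpace ℂ F] [FiniteDimensional ℂ F]
  [NormedAddCommGroup F₁] [InnerProductSpace ℂ F₁] [FiniteDimensional ℂ F₁]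
  [NormedAddCommGroup F₁'] [InnerProductSpace ℂ F₁'] [FiniteDimensional ℂ F₁']
  [NormedAddCommGroup F₂] [InnerProductSpace ℂ F₂] [FiniteDimensional ℂ F₂] {n k₁ k₂ : ℕ}

namespace SpinorModule

/-- Only the dimension of `T` and, for odd `n`, its volume scalar have to be known. The irreducible
side `F` must be the target in `IsIrredFamily.exists_equiv`, so the isomorphism found there is
inverted. -/
theorem exists_equiv_of_family (S : SpinorModule n F) {T : Type*} [AddCommGroup T] [Module ℂ T]
    [FiniteDimensional ℂ T] {e : Fin n → Module.End ℂ T} (he : IsCliffordFamily e)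
    (hd : Module.finrank ℂ T = 2 ^ (n / 2))
    (hv : Odd n → ∃ c : ℂ, S.vol = c • 1 ∧ famVol e = c • 1) :
    ∃ φ : F ≃ₗ[ℂ] T, ∀ j s, φ (S.gen j s) = e j (φ s) := by
  have := S.nontrivial
  obtain ⟨X, hX⟩ := S.isIrredFamily_gen.exists_equiv he S.isCliffordFamily_gen
    (hd.trans S.finrank_eq.symm) fun hn => by
      obtain ⟨c, h₁, h₂⟩ := hv hn
      exact ⟨c, h₂, S.famVol_gen.trans h₁⟩
  exact ⟨X.symm, fun j s => by rw [LinearEquiv.symm_apply_eq, hX, LinearEquiv.apply_symm_apply]⟩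

theorem exists_equiv (S : SpinorModule n F) (S₁ : SpinorModule n F₁)
    (hs : Odd n → ∃ ε : ℤˣ, S.HasSign ε ∧ S₁.HasSign ε) :
    ∃ φ : F ≃ₗ[ℂ] F₁, ∀ v s, φ (S.clifford (CliffordAlgebra.ι (Q n) v) s) =
      S₁.clifford (CliffordAlgebra.ι (Q n) v) (φ s) := by
  obtain ⟨φ, hφ⟩ := S.exists_equiv_of_family S₁.isCliffordFamily_gen S₁.finrank_eq fun hn => by
    obtain ⟨ε, h, h₁⟩ := hs hn
    exact ⟨_, h, S₁.famVol_gen.trans h₁⟩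
  refine ⟨φ, fun v s => ?_⟩
  rw [algHom_ι_eq_complex_sum, algHom_ι_eq_complex_sum]
  simp only [LinearMap.sum_apply, LinearMap.smul_apply, map_sum, map_smul]
  exact Finset.sum_congr rfl fun j _ => congrArg _ (hφ j s)

theorem exists_equiv_left_even (S₁ : SpinorModule k₁ F₁) (S₂ : SpinorModule k₂ F₂)
    (S : SpinorModule (k₁ + k₂) F) {p : ℕ} (hk : k₁ = 2 * p)
    (hs : Odd k₂ → ∃ ε : ℤˣ, S₂.HasSign ε ∧ S.HasSign ((-1) ^ p * ε)) :
    ∃ φ : F ≃ₗ[ℂ] F₁ ⊗[ℂ] F₂, ∀ v w s,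
      φ (S.clifford (CliffordAlgebra.ι (Q (k₁ + k₂)) (Fin.append v w)) s) =
        TensorProduct.map (S₁.clifford (CliffordAlgebra.ι (Q k₁) v)) 1 (φ s) +
          TensorProduct.map (Complex.I ^ p • S₁.vol)
            (S₂.clifford (CliffordAlgebra.ι (Q k₂) w)) (φ s) := by
  have h₁ := S₁.isCliffordFamily_gen
  have he := h₁.leftFamily S₂.isCliffordFamily_gen (h₁.smul_famVol_sq hk)
    (h₁.mul_smul_famVol (hk ▸ even_two_mul p) _)
  obtain ⟨φ, hφ⟩ := S.exists_equiv_of_family he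
    (by rw [Module.finrank_tensorProduct, S₁.finrank_eq, S₂.finrank_eq, ← pow_add]
        congr 1; omega)
    (fun hn => by
      have hn₂ : Odd k₂ := by
        rcases Nat.even_or_odd k₂ with h | h
        · exact absurd hn (Nat.not_odd_iff_even.2 ((hk ▸ even_two_mul p).add h))
        · exact h
      obtain ⟨ε, h₂, h⟩ := hs hn₂
      refine ⟨_, h, ?_⟩
      rw [famVol_leftFamily h₁ hk hn₂, famVol_gen, show S₂.vol = _ from h₂,
        TensorProduct.map_smul_right, tensorMap_one, smul_smul]
      congr 1
      obtain ⟨q, rfl⟩ := hn₂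
      -- The exponent in the definition of the sign grows by `p` from `k₂` to `k₁ + k₂`. This
      -- absorbs the factor `(√-1)^p` of the volume element and leaves `(-1)^p`.
      rw [show (k₁ + (2 * q + 1) + 1) / 2 = p + (2 * q + 1 + 1) / 2 by omega, pow_add]
      push_cast
      ring)
  rw [S₁.famVol_gen] at hφ
  refine ⟨φ, map_clifford_append (φ := φ.toLinearMap) (fun j s => ?_) fun k s => ?_⟩
  · exact (hφ _ s).trans (by rw [leftFamily, Fin.append_left]; rfl)
  · exact (hφ _ s).trans (by rw [leftFamily, Fin.append_right]; rfl)

theorem exists_equiv_right_even (S₁ : SpinorModule k₁ F₁) (S₂ : SpinorModule k₂ F₂)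
    (S : SpinorModule (k₁ + k₂) F) {p : ℕ} (hk : k₂ = 2 * p)
    (hs : Odd k₁ → ∃ ε : ℤˣ, S₁.HasSign ε ∧ S.HasSign ((-1) ^ p * ε)) :
    ∃ φ : F ≃ₗ[ℂ] F₁ ⊗[ℂ] F₂, ∀ v w s,
      φ (S.clifford (CliffordAlgebra.ι (Q (k₁ + k₂)) (Fin.append v w)) s) =
        TensorProduct.map (S₁.clifford (CliffordAlgebra.ι (Q k₁) v))
          (Complex.I ^ p • S₂.vol) (φ s) +
          TensorProduct.map 1 (S₂.clifford (CliffordAlgebra.ι (Q k₂) w)) (φ s) := by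
  have h₂ := S₂.isCliffordFamily_gen
  have he := S₁.isCliffordFamily_gen.rightFamily h₂ (h₂.smul_famVol_sq hk)
    (h₂.mul_smul_famVol (hk ▸ even_two_mul p) _)
  obtain ⟨φ, hφ⟩ := S.exists_equiv_of_family he
    (by rw [Module.finrank_tensorProduct, S₁.finrank_eq, S₂.finrank_eq, ← pow_add]
        congr 1; omega)
    (fun hn => by
      have hn₁ : Odd k₁ := by
        rcases Nat.even_or_odd k₁ with h | h
        · exact absurd hn (Nat.not_odd_iff_even.2 (h.add (hk ▸ even_two_mul p)))
        · exact h
      obtain ⟨ε, h₁, h⟩ := hs hn₁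
      refine ⟨_, h, ?_⟩
      rw [famVol_rightFamily h₂ hk hn₁, famVol_gen, show S₁.vol = _ from h₁,
        TensorProduct.map_smul_left, tensorMap_one, smul_smul]
      congr 1
      obtain ⟨q, rfl⟩ := hn₁
      rw [show (2 * q + 1 + k₂ + 1) / 2 = p + (2 * q + 1 + 1) / 2 by omega, pow_add]
      push_cast
      ring)
  rw [S₂.famVol_gen] at hφ
  refine ⟨φ, map_clifford_append (φ := φ.toLinearMap) (fun j s => ?_) fun k s => ?_⟩
  · exact (hφ _ s).trans (by rw [rightFamily, Fin.append_left]; rfl)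
  · exact (hφ _ s).trans (by rw [rightFamily, Fin.append_right]; rfl)

end SpinorModule

/-- The direct sum of two Clifford modules. -/
def sumHom (c : Cl n →ₐ[ℝ] Module.End ℂ F₁) (c' : Cl n →ₐ[ℝ] Module.End ℂ F₁') :
    Cl n →ₐ[ℝ] Module.End ℂ (WithLp 2 (F₁ × F₁')) where
  toFun a := SmoothBundle.sumMap (c a) (c' a)
  map_one' := by rw [map_one, map_one]; rfl
  map_mul' a b := by rw [map_mul, map_mul]; rfl
  map_zero' := by rw [map_zero, map_zero]; rfl
  map_add' a b := by rw [map_add, map_add]; rfl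
  commutes' r := by rw [AlgHom.commutes, AlgHom.commutes]; rfl

namespace SpinorModule

theorem swapMap_sq (j : F₁' ≃L[ℂ] F₁) :
    (SpinCStructure.swapMap j * SpinCStructure.swapMap j :
      Module.End ℂ (WithLp 2 (F₁ × F₁'))) = 1 := by
  refine LinearMap.ext fun v => (WithLp.linearEquiv 2 ℂ (F₁ × F₁')).injective ?_
  exact Prod.ext (j.apply_symm_apply _) (j.symm_apply_apply _)

/-- This makes the swap a substitute for `(√-1)^p μ₁`. Both components are needed: on one
irreducible module of odd dimension the volume element is a nonzero scalar, but an operator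
anticommuting with all vectors would anticommute with it and so vanish. -/
theorem sumMap_mul_swapMap {a : Module.End ℂ F₁} {a' : Module.End ℂ F₁'} {j : F₁' ≃L[ℂ] F₁}
    (h : ∀ s, j (a' s) = -a (j s)) :
    (SmoothBundle.sumMap a a' * SpinCStructure.swapMap j : Module.End ℂ (WithLp 2 (F₁ × F₁'))) =
      -(SpinCStructure.swapMap j * SmoothBundle.sumMap a a') := by
  have h' : ∀ s, a' (j.symm s) = -j.symm (a s) := fun s => by
    apply j.injective
    rw [h, map_neg, j.apply_symm_apply, j.apply_symm_apply]
  refine LinearMap.ext fun v => (WithLp.linearEquiv 2 ℂ (F₁ × F₁')).injective ?_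
  exact Prod.ext (by exact neg_eq_iff_eq_neg.1 (h _).symm) (h' _)

theorem exists_equiv_odd (S₁ : SpinorModule k₁ F₁) (S₁' : SpinorModule k₁ F₁')
    (S₂ : SpinorModule k₂ F₂) (S : SpinorModule (k₁ + k₂) F) (hk₁ : Odd k₁) (hk₂ : Odd k₂)
    {j : F₁' ≃L[ℂ] F₁} (hj : ∀ v s, j (S₁'.clifford (CliffordAlgebra.ι (Q k₁) v) s) =
      -S₁.clifford (CliffordAlgebra.ι (Q k₁) v) (j s)) :
    ∃ φ : F ≃ₗ[ℂ] WithLp 2 (F₁ × F₁') ⊗[ℂ] F₂, ∀ v w s,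
      φ (S.clifford (CliffordAlgebra.ι (Q (k₁ + k₂)) (Fin.append v w)) s) =
        TensorProduct.map (sumHom S₁.clifford S₁'.clifford (CliffordAlgebra.ι (Q k₁) v)) 1 (φ s) +
          TensorProduct.map (SpinCStructure.swapMap j)
            (S₂.clifford (CliffordAlgebra.ι (Q k₂) w)) (φ s) := by
  have h₁ := isCliffordFamily_gen_of_algHom (sumHom S₁.clifford S₁'.clifford)
  have he := h₁.leftFamily S₂.isCliffordFamily_gen (swapMap_sq j) fun l =>
    sumMap_mul_swapMap (hj (Pi.single l 1))
  obtain ⟨φ, hφ⟩ := S.exists_equiv_of_family he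
    (by rw [Module.finrank_tensorProduct, (WithLp.linearEquiv 2 ℂ (F₁ × F₁')).finrank_eq,
          Module.finrank_prod, S₁.finrank_eq, S₁'.finrank_eq, S₂.finrank_eq, ← two_mul,
          ← pow_succ', ← pow_add]
        obtain ⟨q, rfl⟩ := hk₁
        obtain ⟨r, rfl⟩ := hk₂
        congr 1; omega)
    -- The total dimension is even, so there is no sign to match.
    (fun hn => absurd hn (Nat.not_odd_iff_even.2 (hk₁.add_odd hk₂)))
  refine ⟨φ, map_clifford_append (φ := φ.toLinearMap) (fun j s => ?_) fun k s => ?_⟩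
  · exact (hφ _ s).trans (by rw [leftFamily, Fin.append_left]; rfl)
  · exact (hφ _ s).trans (by rw [leftFamily, Fin.append_right]; rfl)

theorem action_tmul (S : SpinorModule n F) (z : ℂ) (a : Cl n) :
    S.action (z ⊗ₜ a) = z • S.clifford a := by
  refine (Algebra.TensorProduct.lift_tmul _ _ _ _ _).trans ?_
  rw [Algebra.ofId_apply, Algebra.smul_def]

end SpinorModule
end modules

/-! ### Passage from spinor modules to spinor bundles. -/

namespace SpinCStructure
variable {E H M : Type*} [NormedAddCommGroup E] [NormedSpace ℝ E] [FiniteDimensional ℝ E]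
  [TopologicalSpace H] [TopologicalSpace M] [ChartedSpace H M]
  {E' H' M' : Type*} [NormedAddCommGroup E'] [NormedSpace ℝ E'] [FiniteDimensional ℝ E']
  [TopologicalSpace H'] [TopologicalSpace M'] [ChartedSpace H' M']
  {I : ModelWithCorners ℝ E H} {I' : ModelWithCorners ℝ E' H'}
  {C : Type*} [NormedAddCommGroup C] [InnerProductSpace ℂ C] [FiniteDimensional ℂ C]
  {C' : Type*} [NormedAddCommGroup C'] [InnerProductSpace ℂ C'] [FiniteDimensional ℂ C']
  {ι ι' : Type*} [IsManifold I ∞ M] [IsManifold I' ∞ M']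
  {g : Metric I M} {g' : Metric I' M'} {L : SmoothBundle I M C ι} {L' : SmoothBundle I' M' C' ι'}
  {n k₁ k₂ : ℕ} {F F₁ F₁' F₂ : Type*}
  [NormedAddCommGroup F] [InnerProductSpace ℂ F] [FiniteDimensional ℂ F]
  [NormedAddCommGroup F₁] [InnerProductSpace ℂ F₁] [FiniteDimensional ℂ F₁]
  [NormedAddCommGroup F₁'] [InnerProductSpace ℂ F₁'] [FiniteDimensional ℂ F₁']
  [NormedAddCommGroup F₂] [InnerProductSpace ℂ F₂] [FiniteDimensional ℂ F₂]

/-- Evenness of the Clifford factor is all that the bundle isomorphisms use about `Spin^c(n)`. -/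
theorem exists_trans_eq (𝔰 : SpinCStructure g L n) {i j : ι} {x : M}
    (hx : x ∈ L.baseSet i ∩ L.baseSet j) :
    ∃ (z : ℂ) (a : Cl n), a ∈ CliffordAlgebra.evenOdd (Q n) 0 ∧ 𝔰.trans i j x = z ⊗ₜ a := by
  obtain ⟨μ, ⟨z, a, -, ha, h, -⟩, -⟩ := 𝔰.isLift i j x hx
  exact ⟨z, a, ha.2, h⟩

/-- The vectors of a frame have the standard basis as their coordinates in that same frame, so the
volume form acts by the same endomorphism of the model fibre at every point. -/
theorem volMul_eq (𝔰 : SpinCStructure g L n) (S : SpinorModule n F) (x : M) :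
    (show Module.End ℂ F from 𝔰.volMul S x) = S.vol := by
  rw [← S.famVol_gen]
  change (List.ofFn fun l => S.clifford (CliffordAlgebra.ι (Q n)
    ((𝔰.frame (L.indexAt x) x).equivFun (𝔰.frame (L.indexAt x) x l)))).prod =
      (List.ofFn fun l => S.clifford (CliffordAlgebra.ι (Q n) (Pi.single l 1))).prod
  congr 2
  funext l
  congr 2
  funext k
  rw [Module.Basis.equivFun_self, Pi.single_apply]
  simp only [eq_comm]

variable (𝔰₁ : SpinCStructure g L k₁) (𝔰₂ : SpinCStructure g' L' k₂)
  (S₁ : SpinorModule k₁ F₁) (S₁' : SpinorModule k₁ F₁') (S₂ : SpinorModule k₂ F₂)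
  (S : SpinorModule (k₁ + k₂) F)

/-- The isomorphism of spinor bundles given by an isomorphism of the spinor modules as modules
over the even Clifford algebra. -/
def spinorIso {φ : F₁' ≃ₗ[ℂ] F₁}
    (h : ∀ a ∈ CliffordAlgebra.evenOdd (Q k₁) 0, ∀ s,
      φ (S₁'.clifford a s) = S₁.clifford a (φ s)) :
    BundleIso (𝔰₁.spinorBundle S₁') (𝔰₁.spinorBundle S₁) :=
  .ofIntertwining id (fun _ => rfl) (fun _ => rfl) φ fun i j x hx s => by
    obtain ⟨z, a, ha, h₁⟩ := 𝔰₁.exists_trans_eq hx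
    change φ (S₁'.action (𝔰₁.trans i j x) s) = S₁.action (𝔰₁.trans i j x) (φ s)
    rw [h₁, SpinorModule.action_tmul, SpinorModule.action_tmul, LinearMap.smul_apply, map_smul,
      h a ha, LinearMap.smul_apply]

theorem action_prod_trans {i j : ι × ι'} {x : M × M'} {z₁ z₂ : ℂ} {a₁ : Cl k₁} {a₂ : Cl k₂}
    (h₁ : 𝔰₁.trans i.1 j.1 x.1 = z₁ ⊗ₜ a₁) (h₂ : 𝔰₂.trans i.2 j.2 x.2 = z₂ ⊗ₜ a₂) :
    S.action ((𝔰₁.prod 𝔰₂).trans i j x) = (z₁ * z₂) •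
      S.clifford (CliffordAlgebra.map (inl k₁ k₂) a₁ * CliffordAlgebra.map (inr k₁ k₂) a₂) := by
  change S.action (Algebra.TensorProduct.map _ _ _ * Algebra.TensorProduct.map _ _ _) = _
  rw [h₁, h₂, ← SpinorModule.action_tmul]
  simp

/-- The isomorphism from the spinor bundle of a product to a tensor product of spinor bundles given
by an isomorphism of the spinor modules which is equivariant for even elements. -/
def prodIso {φ : F ≃ₗ[ℂ] F₁ ⊗[ℂ] F₂}
    (h : ∀ a₁ ∈ CliffordAlgebra.evenOdd (Q k₁) 0, ∀ a₂ ∈ CliffordAlgebra.evenOdd (Q k₂) 0, ∀ s,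
      φ (S.clifford (CliffordAlgebra.map (inl k₁ k₂) a₁ * CliffordAlgebra.map (inr k₁ k₂) a₂) s) =
        TensorProduct.map (S₁.clifford a₁) (S₂.clifford a₂) (φ s)) :
    BundleIso ((𝔰₁.prod 𝔰₂).spinorBundle S)
      ((𝔰₁.spinorBundle S₁).boxTensor (𝔰₂.spinorBundle S₂)) :=
  .ofIntertwining id (fun _ => rfl) (fun _ => rfl) φ fun i j x hx s => by
    obtain ⟨z₁, a₁, ha₁, h₁⟩ := 𝔰₁.exists_trans_eq ⟨hx.1.1, hx.2.1⟩
    obtain ⟨z₂, a₂, ha₂, h₂⟩ := 𝔰₂.exists_trans_eq ⟨hx.1.2, hx.2.2⟩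
    refine Eq.trans ?_ (TensorProduct.mapL_apply _ _ _).symm
    change φ (S.action ((𝔰₁.prod 𝔰₂).trans i j x) s) = TensorProduct.map
      (S₁.action (𝔰₁.trans i.1 j.1 x.1)) (S₂.action (𝔰₂.trans i.2 j.2 x.2)) (φ s)
    rw [action_prod_trans 𝔰₁ 𝔰₂ S h₁ h₂, LinearMap.smul_apply, map_smul, h a₁ ha₁ a₂ ha₂, h₁, h₂,
      SpinorModule.action_tmul, SpinorModule.action_tmul, TensorProduct.map_smul_left,
      TensorProduct.map_smul_right, smul_smul, LinearMap.smul_apply]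

/-- The isomorphism from the spinor bundle of a product of odd-dimensional manifolds given by an
isomorphism of the spinor modules which is equivariant for even elements. -/
def prodSumIso {φ : F ≃ₗ[ℂ] WithLp 2 (F₁ × F₁') ⊗[ℂ] F₂}
    (h : ∀ a₁ ∈ CliffordAlgebra.evenOdd (Q k₁) 0, ∀ a₂ ∈ CliffordAlgebra.evenOdd (Q k₂) 0, ∀ s,
      φ (S.clifford (CliffordAlgebra.map (inl k₁ k₂) a₁ * CliffordAlgebra.map (inr k₁ k₂) a₂) s) =
        TensorProduct.map (sumHom S₁.clifford S₁'.clifford a₁) (S₂.clifford a₂) (φ s)) :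
    BundleIso ((𝔰₁.prod 𝔰₂).spinorBundle S)
      (((𝔰₁.spinorBundle S₁).directSum (𝔰₁.spinorBundle S₁')).boxTensor
        (𝔰₂.spinorBundle S₂)) :=
  -- The direct sum is trivialised over pairs of indices of the first manifold; the diagonal pairs
  -- match the trivialisations of the source.
  .ofIntertwining (fun i => ((i.1, i.1), i.2))
    (fun i => by
      change Prod.fst ⁻¹' (L.baseSet i.1 ∩ L.baseSet i.1) ∩ _ = _
      rw [inter_self]; rfl)
    (fun _ => rfl) φ fun i j x hx s => by
    obtain ⟨z₁, a₁, ha₁, h₁⟩ := 𝔰₁.exists_trans_eq ⟨hx.1.1, hx.2.1⟩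
    obtain ⟨z₂, a₂, ha₂, h₂⟩ := 𝔰₂.exists_trans_eq ⟨hx.1.2, hx.2.2⟩
    refine Eq.trans ?_ (TensorProduct.mapL_apply _ _ _).symm
    change φ (S.action ((𝔰₁.prod 𝔰₂).trans i j x) s) = TensorProduct.map
      (SmoothBundle.sumMap (S₁.action (𝔰₁.trans i.1 j.1 x.1)) (S₁'.action (𝔰₁.trans i.1 j.1 x.1)))
      (S₂.action (𝔰₂.trans i.2 j.2 x.2)) (φ s)
    have hsum : SmoothBundle.sumMap (z₁ • S₁.clifford a₁) (z₁ • S₁'.clifford a₁) =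
        z₁ • sumHom S₁.clifford S₁'.clifford a₁ := rfl
    rw [action_prod_trans 𝔰₁ 𝔰₂ S h₁ h₂, LinearMap.smul_apply, map_smul, h a₁ ha₁ a₂ ha₂, h₁, h₂,
      SpinorModule.action_tmul, SpinorModule.action_tmul, SpinorModule.action_tmul, hsum,
      TensorProduct.map_smul_left, TensorProduct.map_smul_right, smul_smul, LinearMap.smul_apply]

variable {S₁ S₁' S₂ S}

theorem exists_leftEvenIso {p : ℕ} (hk : k₁ = 2 * p)
    (hs : Odd k₂ → ∃ ε : ℤˣ, S₂.HasSign ε ∧ S.HasSign ((-1) ^ p * ε)) :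
    ∃ Φ : BundleIso ((𝔰₁.prod 𝔰₂).spinorBundle S)
        ((𝔰₁.spinorBundle S₁).boxTensor (𝔰₂.spinorBundle S₂)),
      ∀ x v ψ, Φ.toFun x ((𝔰₁.prod 𝔰₂).cliffordMul S x v ψ) =
        𝔰₁.leftEvenMul 𝔰₂ S₁ S₂ p x v (Φ.toFun x ψ) := by
  obtain ⟨φ, hφ⟩ := SpinorModule.exists_equiv_left_even S₁ S₂ S hk hs
  have hτ := S₁.isCliffordFamily_gen.smul_famVol_sq hk
  rw [S₁.famVol_gen] at hτ
  refine ⟨prodIso 𝔰₁ 𝔰₂ S₁ S₂ S (φ := φ) fun a₁ ha₁ a₂ ha₂ => map_clifford_even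
    (φ := φ.toLinearMap) hτ (mul_one 1) hφ ha₁ ha₂, fun x v ψ => ?_⟩
  obtain ⟨v₁, v₂⟩ := v
  -- Clifford multiplication at `x` uses the preferred frames at `x`, and the coordinates of `(v₁,
  -- v₂)` in the product frame are the two coordinate vectors appended.
  have := hφ ((𝔰₁.frame (L.indexAt x.1) x.1).equivFun v₁)
    ((𝔰₂.frame (L'.indexAt x.2) x.2).equivFun v₂) ψ
  rw [← volMul_eq 𝔰₁ S₁ x.1, TensorProduct.map_smul_left] at this
  exact (congrArg (fun u => φ (S.clifford (CliffordAlgebra.ι (Q (k₁ + k₂)) u) ψ))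
    (prodBasis_equivFun _ _ v₁ v₂)).trans this

theorem exists_rightEvenIso {p : ℕ} (hk : k₂ = 2 * p)
    (hs : Odd k₁ → ∃ ε : ℤˣ, S₁.HasSign ε ∧ S.HasSign ((-1) ^ p * ε)) :
    ∃ Φ : BundleIso ((𝔰₁.prod 𝔰₂).spinorBundle S)
        ((𝔰₁.spinorBundle S₁).boxTensor (𝔰₂.spinorBundle S₂)),
      ∀ x v ψ, Φ.toFun x ((𝔰₁.prod 𝔰₂).cliffordMul S x v ψ) =
        𝔰₁.rightEvenMul 𝔰₂ S₁ S₂ p x v (Φ.toFun x ψ) := by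
  obtain ⟨φ, hφ⟩ := SpinorModule.exists_equiv_right_even S₁ S₂ S hk hs
  have hτ := S₂.isCliffordFamily_gen.smul_famVol_sq hk
  rw [S₂.famVol_gen] at hτ
  refine ⟨prodIso 𝔰₁ 𝔰₂ S₁ S₂ S (φ := φ) fun a₁ ha₁ a₂ ha₂ => map_clifford_even
    (φ := φ.toLinearMap) (mul_one 1) hτ hφ ha₁ ha₂, fun x v ψ => ?_⟩
  obtain ⟨v₁, v₂⟩ := v
  have := hφ ((𝔰₁.frame (L.indexAt x.1) x.1).equivFun v₁)
    ((𝔰₂.frame (L'.indexAt x.2) x.2).equivFun v₂) ψ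
  rw [← volMul_eq 𝔰₂ S₂ x.2, TensorProduct.map_smul_right] at this
  exact (congrArg (fun u => φ (S.clifford (CliffordAlgebra.ι (Q (k₁ + k₂)) u) ψ))
    (prodBasis_equivFun _ _ v₁ v₂)).trans this

/-- `S₁'` and the twist of `S₁` both have sign -1, hence are isomorphic, and an isomorphism onto the
twist anticommutes with vectors as seen in `S₁`. It still commutes with even elements, so it
descends to the bundles. The constant fibre map `j` is recorded because it enters the construction
of the swap. -/
theorem exists_oddSpinorIso (h₁ : S₁.HasSign 1) (h₁' : S₁'.HasSign (-1)) :
    ∃ J : BundleIso (𝔰₁.spinorBundle S₁') (𝔰₁.spinorBundle S₁), ∃ j : F₁' ≃L[ℂ] F₁,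
      (∀ x, J.toFun x = j) ∧ ∀ v s, j (S₁'.clifford (CliffordAlgebra.ι (Q k₁) v) s) =
        -S₁.clifford (CliffordAlgebra.ι (Q k₁) v) (j s) := by
  obtain ⟨φ, hφ⟩ := S₁'.exists_equiv S₁.twist fun hn => ⟨-1, h₁', S₁.hasSign_twist hn h₁⟩
  have hφ' : ∀ v s, φ (S₁'.clifford (CliffordAlgebra.ι (Q k₁) v) s) =
      -S₁.clifford (CliffordAlgebra.ι (Q k₁) v) (φ s) := fun v s => by
    rw [hφ]
    simp [SpinorModule.twist]
  exact ⟨𝔰₁.spinorIso S₁ S₁' (φ := φ) fun a ha s =>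
    algHom_even_intertwines (φ := φ.toLinearMap) hφ' ha s, φ.toContinuousLinearEquiv,
    fun _ => rfl, hφ'⟩

theorem exists_oddIso (hk₁ : Odd k₁) (hk₂ : Odd k₂)
    (J : BundleIso (𝔰₁.spinorBundle S₁') (𝔰₁.spinorBundle S₁)) {j : F₁' ≃L[ℂ] F₁}
    (hJ : ∀ x, J.toFun x = j) (hj : ∀ v s, j (S₁'.clifford (CliffordAlgebra.ι (Q k₁) v) s) =
      -S₁.clifford (CliffordAlgebra.ι (Q k₁) v) (j s)) :
    ∃ Φ : BundleIso ((𝔰₁.prod 𝔰₂).spinorBundle S)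
        (((𝔰₁.spinorBundle S₁).directSum (𝔰₁.spinorBundle S₁')).boxTensor (𝔰₂.spinorBundle S₂)),
      ∀ x v ψ, Φ.toFun x ((𝔰₁.prod 𝔰₂).cliffordMul S x v ψ) =
        𝔰₁.oddMul 𝔰₂ S₁ S₁' S₂ J x v (Φ.toFun x ψ) := by
  obtain ⟨φ, hφ⟩ := SpinorModule.exists_equiv_odd S₁ S₁' S₂ S hk₁ hk₂ hj
  refine ⟨prodSumIso 𝔰₁ 𝔰₂ S₁ S₁' S₂ S (φ := φ) fun a₁ ha₁ a₂ ha₂ => map_clifford_even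
    (φ := φ.toLinearMap) (SpinorModule.swapMap_sq j) (mul_one 1) hφ ha₁ ha₂, fun x v ψ => ?_⟩
  obtain ⟨v₁, v₂⟩ := v
  have := hφ ((𝔰₁.frame (L.indexAt x.1) x.1).equivFun v₁)
    ((𝔰₂.frame (L'.indexAt x.2) x.2).equivFun v₂) ψ
  rw [← show (show F₁' ≃L[ℂ] F₁ from J.toFun x.1) = j from hJ x.1] at this
  exact (congrArg (fun u => φ (S.clifford (CliffordAlgebra.ι (Q (k₁ + k₂)) u) ψ))
    (prodBasis_equivFun _ _ v₁ v₂)).trans this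

theorem int_units_eq_or_eq_neg (a b : ℤˣ) : a = b ∨ a = -b := by
  revert a b; decide

/-- If the sign condition fails, the odd-dimensional factor is replaced by its twist, for which it
holds. The twist has the same even action, so the isomorphism obtained is still one for the original
bundles; only the formula for vectors is lost. -/
theorem nonempty_prodIso_of_even (hk : Even k₁ ∨ Even k₂) :
    Nonempty (BundleIso ((𝔰₁.prod 𝔰₂).spinorBundle S)
      ((𝔰₁.spinorBundle S₁).boxTensor (𝔰₂.spinorBundle S₂))) := by
  rcases hk with hk | hk
  · obtain ⟨p, hp⟩ := hk.exists_two_nsmul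
    rw [nsmul_eq_mul, Nat.cast_ofNat] at hp
    have hτ := S₁.isCliffordFamily_gen.smul_famVol_sq hp
    -- `T` is `S₂` or its twist, whichever has the sign compatible with `S`.
    obtain ⟨T, hT, hs⟩ : ∃ T : SpinorModule k₂ F₂,
        (∀ a ∈ CliffordAlgebra.evenOdd (Q k₂) 0, T.clifford a = S₂.clifford a) ∧
        (Odd k₂ → ∃ ε : ℤˣ, T.HasSign ε ∧ S.HasSign ((-1) ^ p * ε)) := by
      rcases Nat.even_or_odd k₂ with h | h
      · exact ⟨S₂, fun _ _ => rfl, fun h' => absurd h' (Nat.not_odd_iff_even.2 h)⟩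
      · obtain ⟨ε₂, h₂⟩ := S₂.exists_hasSign h
        obtain ⟨ε, hε⟩ := S.exists_hasSign (hk.add_odd h)
        rcases int_units_eq_or_eq_neg ε ((-1) ^ p * ε₂) with h' | h'
        · exact ⟨S₂, fun _ _ => rfl, fun _ => ⟨ε₂, h₂, h' ▸ hε⟩⟩
        · exact ⟨S₂.twist, fun _ => S₂.twist_clifford_of_even, fun _ =>
            ⟨-ε₂, S₂.hasSign_twist h h₂, by rwa [mul_neg, ← h']⟩⟩
    rw [S₁.famVol_gen] at hτ
    obtain ⟨φ, hφ⟩ := SpinorModule.exists_equiv_left_even S₁ T S hp hs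
    exact ⟨prodIso 𝔰₁ 𝔰₂ S₁ S₂ S (φ := φ) fun a₁ ha₁ a₂ ha₂ s => by
      rw [← hT a₂ ha₂]
      exact map_clifford_even (φ := φ.toLinearMap) hτ (mul_one 1) hφ ha₁ ha₂ s⟩
  · obtain ⟨p, hp⟩ := hk.exists_two_nsmul
    rw [nsmul_eq_mul, Nat.cast_ofNat] at hp
    have hτ := S₂.isCliffordFamily_gen.smul_famVol_sq hp
    obtain ⟨T, hT, hs⟩ : ∃ T : SpinorModule k₁ F₁,
        (∀ a ∈ CliffordAlgebra.evenOdd (Q k₁) 0, T.clifford a = S₁.clifford a) ∧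
        (Odd k₁ → ∃ ε : ℤˣ, T.HasSign ε ∧ S.HasSign ((-1) ^ p * ε)) := by
      rcases Nat.even_or_odd k₁ with h | h
      · exact ⟨S₁, fun _ _ => rfl, fun h' => absurd h' (Nat.not_odd_iff_even.2 h)⟩
      · obtain ⟨ε₁, h₁⟩ := S₁.exists_hasSign h
        obtain ⟨ε, hε⟩ := S.exists_hasSign (h.add_even hk)
        rcases int_units_eq_or_eq_neg ε ((-1) ^ p * ε₁) with h' | h'
        · exact ⟨S₁, fun _ _ => rfl, fun _ => ⟨ε₁, h₁, h' ▸ hε⟩⟩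
        · exact ⟨S₁.twist, fun _ => S₁.twist_clifford_of_even, fun _ =>
            ⟨-ε₁, S₁.hasSign_twist h h₁, by rwa [mul_neg, ← h']⟩⟩
    rw [S₂.famVol_gen] at hτ
    obtain ⟨φ, hφ⟩ := SpinorModule.exists_equiv_right_even T S₂ S hp hs
    exact ⟨prodIso 𝔰₁ 𝔰₂ S₁ S₂ S (φ := φ) fun a₁ ha₁ a₂ ha₂ s => by
      rw [← hT a₁ ha₁]
      exact map_clifford_even (φ := φ.toLinearMap) (mul_one 1) hτ hφ ha₁ ha₂ s⟩

end SpinCStructure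

end SpinC
end

theorem lemma2p1 {k₁ k₂ : ℕ}
    {M₁ M₂ : Type*}
    [TopologicalSpace M₁] [ChartedSpace (EuclideanSpace ℝ (Fin k₁)) M₁] [IsManifold (𝓡 k₁) ∞ M₁]
    [TopologicalSpace M₂] [ChartedSpace (EuclideanSpace ℝ (Fin k₂)) M₂] [IsManifold (𝓡 k₂) ∞ M₂]
    (g₁ : SpinC.Metric (𝓡 k₁) M₁) (g₂ : SpinC.Metric (𝓡 k₂) M₂)
    {ι₁ ι₂ : Type*}
    (L₁ : SpinC.SmoothBundle (𝓡 k₁) M₁ ℂ ι₁) (L₂ : SpinC.SmoothBundle (𝓡 k₂) M₂ ℂ ι₂)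
    (𝔰₁ : SpinC.SpinCStructure g₁ L₁ k₁) (𝔰₂ : SpinC.SpinCStructure g₂ L₂ k₂)
    {F₁ F₁' F₂ F : Type*}
    [NormedAddCommGroup F₁] [InnerProductSpace ℂ F₁] [FiniteDimensional ℂ F₁]
    [NormedAddCommGroup F₁'] [InnerProductSpace ℂ F₁'] [FiniteDimensional ℂ F₁']
    [NormedAddCommGroup F₂] [InnerProductSpace ℂ F₂] [FiniteDimensional ℂ F₂]
    [NormedAddCommGroup F] [InnerProductSpace ℂ F] [FiniteDimensional ℂ F] :
    -- at least one of the dimensions is even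
    (∀ (S₁ : SpinC.SpinorModule k₁ F₁) (S₂ : SpinC.SpinorModule k₂ F₂)
      (S : SpinC.SpinorModule (k₁ + k₂) F),
      (Even k₁ ∨ Even k₂ →
        Nonempty (SpinC.BundleIso ((𝔰₁.prod 𝔰₂).spinorBundle S)
          ((𝔰₁.spinorBundle S₁).boxTensor (𝔰₂.spinorBundle S₂)))) ∧
      (∀ p : ℕ, k₁ = 2 * p →
        (Odd k₂ → ∃ ε : ℤˣ, S₂.HasSign ε ∧ S.HasSign ((-1) ^ p * ε)) →
        ∃ Φ : SpinC.BundleIso ((𝔰₁.prod 𝔰₂).spinorBundle S)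
            ((𝔰₁.spinorBundle S₁).boxTensor (𝔰₂.spinorBundle S₂)),
          ∀ x v ψ, Φ.toFun x ((𝔰₁.prod 𝔰₂).cliffordMul S x v ψ) =
            𝔰₁.leftEvenMul 𝔰₂ S₁ S₂ p x v (Φ.toFun x ψ)) ∧
      (∀ p : ℕ, k₂ = 2 * p →
        (Odd k₁ → ∃ ε : ℤˣ, S₁.HasSign ε ∧ S.HasSign ((-1) ^ p * ε)) →
        ∃ Φ : SpinC.BundleIso ((𝔰₁.prod 𝔰₂).spinorBundle S)
            ((𝔰₁.spinorBundle S₁).boxTensor (𝔰₂.spinorBundle S₂)),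
          ∀ x v ψ, Φ.toFun x ((𝔰₁.prod 𝔰₂).cliffordMul S x v ψ) =
            𝔰₁.rightEvenMul 𝔰₂ S₁ S₂ p x v (Φ.toFun x ψ))) ∧
    -- both dimensions are odd
    (Odd k₁ → Odd k₂ →
      ∀ (S₁' : SpinC.SpinorModule k₁ F₁) (S₁'' : SpinC.SpinorModule k₁ F₁')
        (S₂ : SpinC.SpinorModule k₂ F₂) (S : SpinC.SpinorModule (k₁ + k₂) F),
        S₁'.HasSign 1 → S₁''.HasSign (-1) →
        ∃ J : SpinC.BundleIso (𝔰₁.spinorBundle S₁'') (𝔰₁.spinorBundle S₁'),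
          (∀ x v φ, J.toFun x (𝔰₁.cliffordMul S₁'' x v φ) =
            - 𝔰₁.cliffordMul S₁' x v (J.toFun x φ)) ∧
          ∃ Φ : SpinC.BundleIso ((𝔰₁.prod 𝔰₂).spinorBundle S)
              (((𝔰₁.spinorBundle S₁').directSum (𝔰₁.spinorBundle S₁'')).boxTensor
                (𝔰₂.spinorBundle S₂)),
            ∀ x v ψ, Φ.toFun x ((𝔰₁.prod 𝔰₂).cliffordMul S x v ψ) =
              𝔰₁.oddMul 𝔰₂ S₁' S₁'' S₂ J x v (Φ.toFun x ψ)) := by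
  refine ⟨fun S₁ S₂ S => ⟨fun hk => 𝔰₁.nonempty_prodIso_of_even 𝔰₂ hk,
    fun p hp hs => 𝔰₁.exists_leftEvenIso 𝔰₂ hp hs,
    fun p hp hs => 𝔰₁.exists_rightEvenIso 𝔰₂ hp hs⟩,
    fun hk₁ hk₂ S₁' S₁'' S₂ S h₁ h₁' => ?_⟩
  obtain ⟨J, j, hJ, hj⟩ := 𝔰₁.exists_oddSpinorIso h₁ h₁'
  refine ⟨J, fun x v φ => ?_, 𝔰₁.exists_oddIso 𝔰₂ hk₁ hk₂ J hJ hj⟩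
  rw [hJ]
  exact hj _ φ
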